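/- A planar binary tree is a rooted planar tree in which every vertex has either no children (a leaf) or exactly two ordered children. A binary tree $T$ contains a binary tree $t$ (a tree pattern) if some vertex $v$ of $T$ is such that the subtree of $T$ formed by $v$ and all its descendants can be obtained from $t$ by grafting binary trees onto leaves of $t$; otherwise $T$ avoids $t$. Let $Av_t(x)=\sum_{n\ge 1}a_nx^n$, where $a_n$ is the number of binary trees with $n$ vertices (internal vertices and leaves) that avoid $t$. Two patterns $s,t$ are Wilf equivalent if $Av_s(x)=Av_t(x)$, and $A(n)$ denotes the number of Wilf equivalence classes of patterns with $n$ leaves. For a field $K$ and a pattern $t$ with $n$ leaves, let $P_t=\mathcal F/(t)$ be the one-relator binary monomial operad with relation $t$ of arity $n$: here $\mathcal F$ is the free nonsymmetric $K$-linear operad on one binary operation (its component of arity $m$ has the binary trees with $m$ leaves as a basis, and the partial compositions are given by grafting), and $(t)$ is the operadic ideal generated by $t$. Two such operads are Wilf equivalent if their generating series $\sum_m \dim P(m)\,z^m$ coincide. Theorem. $A(8)=43$ (not $44$, the value listed by Rowland). Moreover, over every field $K$, for all patterns $s,t$ with $8$ leaves the operads $P_s$ and $P_t$ are Wilf equivalent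 if and only if the patterns $s$ and $t$ are Wilf equivalent; hence the number of Wilf classes of one-relator binary monomial operads with a relation of arity $8$ is also exactly $43$. -/

import Mathlib

open scoped PowerSeries

/-! ### Planar binary trees, pattern avoidance and Wilf equivalence

A planar (full) binary tree is an element of `BinaryTree Unit`: `nil` is a single leaf (free end) and
`node () l r` is a root with left subtree `l` and right subtree `r`. -/

/-- The set of binary trees with `n` leaves; it is used both for tree patterns and for
nonsymmetric monomials of arity `n` in one binary operation. -/
abbrev TreeWithLeaves (n : ℕ) : Type := {T : BinaryTree Unit // T.numLeaves = n}

/-- `RootedSubtree t T`: the tree `T` can be obtained from `t` by grafting trees onto leaves of `t`. -/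
def RootedSubtree : BinaryTree Unit → BinaryTree Unit → Prop
  | .nil, _ => True
  | .node _ _ _, .nil => False
  | .node _ l r, .node _ l' r' => RootedSubtree l l' ∧ RootedSubtree r r'

/-- `ContainsPattern t T`: some (not necessarily proper) subtree of `T`, consisting of a vertex and all
its descendants, has `t` as a rooted subtree. -/
def ContainsPattern (t : BinaryTree Unit) : BinaryTree Unit → Prop
  | .nil => RootedSubtree t .nil
  | .node a l r => RootedSubtree t (.node a l r) ∨ ContainsPattern t l ∨ ContainsPattern t r

/-- `T` avoids the pattern `t`. -/
def AvoidsPattern (t T : BinaryTree Unit) : Prop := ¬ ContainsPattern t T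

/-- The number of all vertices (internal vertices and leaves) of a binary tree. -/
def numVertices (T : BinaryTree Unit) : ℕ := T.numNodes + T.numLeaves

/-- The avoidance function `Av_t(x) = ∑ aₙ xⁿ`, where `aₙ` is the number of binary trees with `n`
vertices that avoid `t`. -/
noncomputable def avoidanceSeries (t : BinaryTree Unit) : ℤ⟦X⟧ :=
  PowerSeries.mk fun n => (({T | numVertices T = n ∧ AvoidsPattern t T}.ncard : ℕ) : ℤ)

/-- Two patterns are Wilf equivalent if their avoidance functions are equal. -/
def WilfEquivalent (s t : BinaryTree Unit) : Prop := avoidanceSeries s = avoidanceSeries t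

/-- Wilf equivalence on patterns with `n` leaves. -/
def wilfSetoid (n : ℕ) : Setoid (TreeWithLeaves n) where
  r s t := WilfEquivalent s.1 t.1
  iseqv := ⟨fun _ => rfl, fun h => Eq.symm h, fun h h' => Eq.trans h h'⟩

/-- `A(n)`: the number of Wilf classes of single binary tree patterns with `n` leaves. -/
noncomputable def numWilfClasses (n : ℕ) : ℕ := Nat.card (Quotient (wilfSetoid n))

/-! ### Nonsymmetric operads -/

universe u v

/-- A nonsymmetric `K`-linear operad in terms of partial compositions. The composition
`comp h i a b` is `a ∘ᵢ b`, with the inputs of `a` numbered from `0`; the arity of the result is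
`n = l + m - 1`, written as `n + 1 = l + m`. -/
structure NSOperad (K : Type u) [Field K] where
  obj : ℕ → Type v
  [addCommGroup : ∀ n, AddCommGroup (obj n)]
  [module : ∀ n, Module K (obj n)]
  one : obj 1
  comp : ∀ {l m n : ℕ}, n + 1 = l + m → Fin l → (obj l →ₗ[K] obj m →ₗ[K] obj n)
  one_comp : ∀ {m : ℕ} (h : m + 1 = 1 + m) (i : Fin 1) (b : obj m), comp h i one b = b
  comp_one : ∀ {l : ℕ} (h : l + 1 = l + 1) (i : Fin l) (a : obj l), comp h i a one = a
  /-- Sequential composition: `(a ∘ᵢ b) ∘ᵢ₊ⱼ c = a ∘ᵢ (b ∘ⱼ c)`. -/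
  comp_seq : ∀ {l m n p q r : ℕ} (h₁ : p + 1 = l + m) (h₂ : q + 1 = p + n)
    (h₃ : r + 1 = m + n) (h₄ : q + 1 = l + r) (i : Fin l) (j : Fin m) (k : Fin p),
    (k : ℕ) = i + j → ∀ (a : obj l) (b : obj m) (c : obj n),
      comp h₂ k (comp h₁ i a b) c = comp h₄ i a (comp h₃ j b c)
  /-- Parallel composition: `(a ∘ᵢ b) ∘ₖ₊ₘ₋₁ c = (a ∘ₖ c) ∘ᵢ b` for `i < k`. -/
  comp_par : ∀ {l m n p q r : ℕ} (h₁ : p + 1 = l + m) (h₂ : q + 1 = p + n)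
    (h₃ : r + 1 = l + n) (h₄ : q + 1 = r + m) (i k : Fin l) (k' : Fin p) (i' : Fin r),
    i < k → (k' : ℕ) + 1 = k + m → (i' : ℕ) = i → ∀ (a : obj l) (b : obj m) (c : obj n),
      comp h₂ k' (comp h₁ i a b) c = comp h₄ i' (comp h₃ k a c) b

namespace NSOperad

attribute [instance] NSOperad.addCommGroup NSOperad.module

variable {K : Type u} [Field K]

/-- The generating series `G_P(z) = ∑ dim P(n) zⁿ`. -/
noncomputable def generatingSeries (P : NSOperad.{u, v} K) : ℤ⟦X⟧ :=
  PowerSeries.mk fun n => ((Module.finrank K (P.obj n) : ℕ) : ℤ)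

/-- A (two-sided) operadic ideal. -/
structure OperadIdeal (P : NSOperad.{u, v} K) where
  carrier : ∀ n, Submodule K (P.obj n)
  comp_left_mem : ∀ {l m n : ℕ} (h : n + 1 = l + m) (i : Fin l) {a : P.obj l} (b : P.obj m),
    a ∈ carrier l → P.comp h i a b ∈ carrier n
  comp_right_mem : ∀ {l m n : ℕ} (h : n + 1 = l + m) (i : Fin l) (a : P.obj l) {b : P.obj m},
    b ∈ carrier m → P.comp h i a b ∈ carrier n

/-- The smallest ideal containing a given element `x` of arity `d`: the intersection of all ideals
containing it. -/
def idealGenerated (P : NSOperad.{u, v} K) {d : ℕ} (x : P.obj d) : P.OperadIdeal where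
  carrier n := ⨅ I : {I : P.OperadIdeal // x ∈ I.carrier d}, I.1.carrier n
  comp_left_mem h i a b ha := by
    rw [Submodule.mem_iInf] at ha ⊢
    exact fun I => I.1.comp_left_mem h i b (ha I)
  comp_right_mem h i a b hb := by
    rw [Submodule.mem_iInf] at hb ⊢
    exact fun I => I.1.comp_right_mem h i a (hb I)

/-- The composition induced on the quotient by an ideal. -/
def quotientComp (P : NSOperad.{u, v} K) (I : P.OperadIdeal) {l m n : ℕ} (h : n + 1 = l + m)
    (i : Fin l) :
    (P.obj l ⧸ I.carrier l) →ₗ[K] (P.obj m ⧸ I.carrier m) →ₗ[K] (P.obj n ⧸ I.carrier n) :=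
  (I.carrier l).liftQ
    { toFun := fun a => (I.carrier m).liftQ ((I.carrier n).mkQ ∘ₗ P.comp h i a) (by
        intro b hb
        simpa using I.comp_right_mem h i a hb)
      map_add' := by
        intro a a'
        ext b
        simp
      map_smul' := by
        intro c a
        ext b
        simp }
    (by
      intro a ha
      rw [LinearMap.mem_ker]
      ext b
      simpa using I.comp_left_mem h i b ha)

theorem quotientComp_mk (P : NSOperad.{u, v} K) (I : P.OperadIdeal) {l m n : ℕ}
    (h : n + 1 = l + m) (i : Fin l) (a : P.obj l) (b : P.obj m) :
    P.quotientComp I h i (Submodule.Quotient.mk a) (Submodule.Quotient.mk b)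
      = Submodule.Quotient.mk (P.comp h i a b) := rfl

/-- The quotient operad `P / I`. -/
def quotient (P : NSOperad.{u, v} K) (I : P.OperadIdeal) : NSOperad.{u, v} K where
  obj n := P.obj n ⧸ I.carrier n
  one := Submodule.Quotient.mk P.one
  comp h i := P.quotientComp I h i
  one_comp h i b := by
    induction b using Submodule.Quotient.induction_on with
    | H b => rw [quotientComp_mk, P.one_comp]
  comp_one h i a := by
    induction a using Submodule.Quotient.induction_on with
    | H a => rw [quotientComp_mk, P.comp_one]
  comp_seq h₁ h₂ h₃ h₄ i j k hk a b c := by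
    induction a using Submodule.Quotient.induction_on with
    | H a =>
      induction b using Submodule.Quotient.induction_on with
      | H b =>
        induction c using Submodule.Quotient.induction_on with
        | H c => simp only [quotientComp_mk, P.comp_seq h₁ h₂ h₃ h₄ i j k hk]
  comp_par h₁ h₂ h₃ h₄ i k k' i' hik hk hi a b c := by
    induction a using Submodule.Quotient.induction_on with
    | H a =>
      induction b using Submodule.Quotient.induction_on with
      | H b =>
        induction c using Submodule.Quotient.induction_on with
        | H c => simp only [quotientComp_mk, P.comp_par h₁ h₂ h₃ h₄ i k k' i' hik hk hi]

end NSOperad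

/-! ### The free nonsymmetric operad on one binary generator -/

/-- Graft the root of `T` onto the `i`-th leaf of `S` (leaves are numbered from left to right,
starting with `0`). -/
def graft : BinaryTree Unit → ℕ → BinaryTree Unit → BinaryTree Unit
  | .nil, _, T => T
  | .node a l r, i, T =>
    if i < l.numLeaves then .node a (graft l i T) r else .node a l (graft r (i - l.numLeaves) T)

theorem numLeaves_graft (S : BinaryTree Unit) (i : ℕ) (T : BinaryTree Unit) :
    (graft S i T).numLeaves + 1 = S.numLeaves + T.numLeaves := by
  induction S generalizing i with
  | nil => simp [graft, Nat.add_comm]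
  | node a l r hl hr =>
    have h1 := hl i
    have h2 := hr (i - l.numLeaves)
    simp only [graft]
    split_ifs <;> simp only [BinaryTree.numLeaves] <;> omega

theorem graft_nil (S : BinaryTree Unit) (i : ℕ) : graft S i .nil = S := by
  induction S generalizing i with
  | nil => rfl
  | node a l r hl hr => simp only [graft, hl, hr, ite_self]

theorem graft_seq (A B C : BinaryTree Unit) (i j : ℕ) (hi : i < A.numLeaves)
    (hj : j < B.numLeaves) : graft (graft A i B) (i + j) C = graft A i (graft B j C) := by
  induction A generalizing i with
  | nil =>
    have : i = 0 := by simpa using hi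
    simp [graft, this]
  | node a l r hl hr =>
    have h1 := numLeaves_graft l i B
    simp only [BinaryTree.numLeaves] at hi
    by_cases h : i < l.numLeaves
    · have h2 : i + j < (graft l i B).numLeaves := by omega
      simp only [graft, if_pos h, if_pos h2, hl i h]
    · have h2 : ¬ i + j < l.numLeaves := by omega
      have h3 : i + j - l.numLeaves = i - l.numLeaves + j := by omega
      simp only [graft, if_neg h, if_neg h2, h3, hr (i - l.numLeaves) (by omega)]

theorem graft_par (A B C : BinaryTree Unit) (i k k' : ℕ) (hik : i < k) (hk : k < A.numLeaves)
    (hk' : k' + 1 = k + B.numLeaves) :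
    graft (graft A i B) k' C = graft (graft A k C) i B := by
  induction A generalizing i k k' with
  | nil =>
    simp only [BinaryTree.numLeaves] at hk
    omega
  | node a l r hl hr =>
    have h1 := numLeaves_graft l i B
    have h1' := numLeaves_graft l k C
    have hB := B.numLeaves_pos
    have hC := C.numLeaves_pos
    simp only [BinaryTree.numLeaves] at hk
    by_cases h : k < l.numLeaves
    · have h2 : i < l.numLeaves := by omega
      have h3 : k' < (graft l i B).numLeaves := by omega
      have h4 : i < (graft l k C).numLeaves := by omega
      simp only [graft, if_pos h, if_pos h2, if_pos h3, if_pos h4, hl i k k' hik h hk']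
    · by_cases h2 : i < l.numLeaves
      · have h3 : ¬ k' < (graft l i B).numLeaves := by omega
        have h4 : k' - (graft l i B).numLeaves = k - l.numLeaves := by omega
        simp only [graft, if_neg h, if_pos h2, if_neg h3, h4]
      · have h3 : ¬ k' < l.numLeaves := by omega
        simp only [graft, if_neg h, if_neg h2, if_neg h3]
        rw [hr (i - l.numLeaves) (k - l.numLeaves) (k' - l.numLeaves) (by omega) (by omega)
          (by omega)]

/-- Grafting of trees with prescribed numbers of leaves. -/
def graftLeaves {l m n : ℕ} (h : n + 1 = l + m) (i : Fin l) (S : TreeWithLeaves l)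
    (T : TreeWithLeaves m) : TreeWithLeaves n :=
  ⟨graft S.1 i T.1, by
    have h1 := numLeaves_graft S.1 i T.1
    rw [S.2, T.2] at h1
    omega⟩

/-- Bilinear extension of grafting to formal linear combinations of trees. -/
noncomputable def freeComp (K : Type u) [Field K] {l m n : ℕ} (h : n + 1 = l + m) (i : Fin l) :
    (TreeWithLeaves l →₀ K) →ₗ[K] (TreeWithLeaves m →₀ K) →ₗ[K] (TreeWithLeaves n →₀ K) :=
  Finsupp.linearCombination K fun S => Finsupp.lmapDomain K K (graftLeaves h i S)

theorem freeComp_single (K : Type u) [Field K] {l m n : ℕ} (h : n + 1 = l + m) (i : Fin l)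
    (S : TreeWithLeaves l) (T : TreeWithLeaves m) (a b : K) :
    freeComp K h i (Finsupp.single S a) (Finsupp.single T b)
      = Finsupp.single (graftLeaves h i S T) (a * b) := by
  simp [freeComp, Finsupp.linearCombination_single, Finsupp.mapDomain_single]

/-- The free nonsymmetric operad on one binary operation: its component of arity `n` has the binary
trees with `n` leaves as a basis, and partial compositions are given by grafting. -/
noncomputable def freeBinaryOperad (K : Type u) [Field K] : NSOperad.{u, u} K where
  obj n := TreeWithLeaves n →₀ K
  one := Finsupp.single ⟨.nil, rfl⟩ 1
  comp h i := freeComp K h i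
  one_comp h i b := by
    induction b using Finsupp.induction_linear with
    | zero => simp
    | add f g hf hg => rw [map_add, hf, hg]
    | single T x =>
      rw [freeComp_single, one_mul]
      rfl
  comp_one h i a := by
    induction a using Finsupp.induction_linear with
    | zero => simp
    | add f g hf hg => rw [map_add, LinearMap.add_apply, hf, hg]
    | single T x =>
      rw [freeComp_single, mul_one]
      congr 1
      exact Subtype.ext (graft_nil _ _)
  comp_seq h₁ h₂ h₃ h₄ i j k hk a b c := by
    induction a using Finsupp.induction_linear with
    | zero => simp
    | add f g hf hg => simp only [map_add, LinearMap.add_apply, hf, hg]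
    | single A x =>
      induction b using Finsupp.induction_linear with
      | zero => simp
      | add f g hf hg => simp only [map_add, LinearMap.add_apply, hf, hg]
      | single B y =>
        induction c using Finsupp.induction_linear with
        | zero => simp
        | add f g hf hg => simp only [map_add, hf, hg]
        | single C z =>
          simp only [freeComp_single, mul_assoc]
          congr 1
          apply Subtype.ext
          simp only [graftLeaves, hk]
          exact graft_seq _ _ _ _ _ (by rw [A.2]; exact i.2) (by rw [B.2]; exact j.2)
  comp_par h₁ h₂ h₃ h₄ i k k' i' hik hk hi a b c := by
    induction a using Finsupp.induction_linear with
    | zero => simp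
    | add f g hf hg => simp only [map_add, LinearMap.add_apply, hf, hg]
    | single A x =>
      induction b using Finsupp.induction_linear with
      | zero => simp
      | add f g hf hg => simp only [map_add, LinearMap.add_apply, hf, hg]
      | single B y =>
        induction c using Finsupp.induction_linear with
        | zero => simp
        | add f g hf hg => simp only [map_add, LinearMap.add_apply, hf, hg]
        | single C z =>
          simp only [freeComp_single, mul_right_comm]
          congr 1
          apply Subtype.ext
          simp only [graftLeaves, hi]
          exact graft_par _ _ _ _ _ _ hik (by rw [A.2]; exact k.2) (by rw [B.2]; exact hk)

/-! ### One-relator binary monomial operads -/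

/-- The operad with one binary generator and the single monomial relation `t = 0`, of arity `n`. -/
noncomputable def oneRelatorOperad (K : Type u) [Field K] {n : ℕ} (t : TreeWithLeaves n) :
    NSOperad.{u, u} K :=
  (freeBinaryOperad K).quotient
    ((freeBinaryOperad K).idealGenerated (d := n) (Finsupp.single t (1 : K)))

/-- Two operads are Wilf equivalent if their generating series coincide. -/
def NSOperad.WilfEquivalent {K : Type u} [Field K] (P Q : NSOperad.{u, u} K) : Prop :=
  P.generatingSeries = Q.generatingSeries

/-- Wilf equivalence of the one-relator binary monomial operads with relation of arity `n`. -/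
def operadWilfSetoid (K : Type u) [Field K] (n : ℕ) : Setoid (TreeWithLeaves n) where
  r s t := NSOperad.WilfEquivalent (oneRelatorOperad K s) (oneRelatorOperad K t)
  iseqv := ⟨fun _ => rfl, fun h => Eq.symm h, fun h h' => Eq.trans h h'⟩

/-- The number of Wilf classes of one-relator binary monomial operads over `K` with relation of
arity `n`. -/
noncomputable def numOperadWilfClasses (K : Type u) [Field K] (n : ℕ) : ℕ :=
  Nat.card (Quotient (operadWilfSetoid K n))

/-! For a pattern t and a tree p let G_p count, by leaves, the t-avoiding trees that have p as a
rooted subtree. Splitting a tree at its root, and using inclusion-exclusion for an occurrence of t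
at the root, gives G_p = [p = nil] x + G_{p.left} G_{p.right} - G_{(p ∪ t).left} G_{(p ∪ t).right}
(`avoiderSeries_eq`), while G_p = 0 once t is a rooted subtree of p. Starting from p = nil only
finitely many p occur, because their heights never exceed that of t. No G_p has a constant term, so
the system is X-adically contracting: its solution is unique, and a solution modulo X^L is correct
modulo X^L (`dvd_sub_avoiderSeries`).

At most 43 classes: a certificate for a set of patterns consists of a polynomial F(b, x), enough
coefficients to single out a power series root b by Hensel's lemma (`exists_root`), and rational
functions in b and x. If these functions satisfy the systems of all members modulo F, uniqueness
identifies the function with label 1 with the avoider series of every member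
(`Certificate.exists_avoiderSeries_eq`). Up to reflection (`avoiderSeries_mirror`), 35 certificates
and 8 isolated patterns cover all patterns with eight leaves.

At least 43 classes: the coefficients below X^26 are computed for one pattern of each class and are
pairwise different (`distinct_codes`).

Operads: the ideal generated by the monomial t is spanned by the trees containing t
(`carrier_idealGenerated`), so over every field the dimensions count avoiders. Both equivalence
relations thus say that the series G_nil agree, and `card_quotient_eq` counts the classes of both.

The computations run on large integers by Kronecker substitution. The procedures that find states,
solutions and quotients need no correctness proof, since their output is checked. -/

namespace PatternAvoidance

open BinaryTree PowerSeries

/-! ### Avoiders with a prescribed rooted subtree -/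

/-- The smallest tree having both arguments as rooted subtrees. -/
def union : BinaryTree Unit → BinaryTree Unit → BinaryTree Unit
  | .nil, q => q
  | .node a l r, .nil => .node a l r
  | .node a l r, .node _ l' r' => .node a (union l l') (union r r')

theorem rootedSubtree_nil (T : BinaryTree Unit) : RootedSubtree .nil T := by
  cases T <;> trivial

/-- Both branches of `nil` are `nil`, so one formula covers leaves and nodes p; this is why the
recursion can be stated uniformly in p. -/
theorem rootedSubtree_node (p l r : BinaryTree Unit) (a : Unit) :
    RootedSubtree p (.node a l r) ↔ RootedSubtree p.left l ∧ RootedSubtree p.right r := by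
  cases p with
  | nil => simp [BinaryTree.left, BinaryTree.right, rootedSubtree_nil]
  | node b p q => rfl

/-- Two conditions at the root merge into one, which keeps inclusion-exclusion inside the family
`avoiderSeries t p`. -/
theorem rootedSubtree_union (p q T : BinaryTree Unit) :
    RootedSubtree (union p q) T ↔ RootedSubtree p T ∧ RootedSubtree q T := by
  induction p generalizing q T with
  | nil => simp [union, rootedSubtree_nil]
  | node a l r hl hr =>
    cases q with
    | nil => simp [union, rootedSubtree_nil]
    | node b l' r' =>
      cases T with
      | nil => simp [union, RootedSubtree]
      | node c u w =>
        simp only [union, RootedSubtree, hl, hr]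
        tauto

theorem rootedSubtree_trans {s t T : BinaryTree Unit} (h : RootedSubtree s t)
    (h' : RootedSubtree t T) : RootedSubtree s T := by
  induction s generalizing t T with
  | nil => exact rootedSubtree_nil T
  | node a l r hl hr =>
    cases t with
    | nil => exact h.elim
    | node b l' r' =>
      cases T with
      | nil => exact h'.elim
      | node c u w => exact ⟨hl h.1 h'.1, hr h.2 h'.2⟩

theorem containsPattern_of_rootedSubtree {t T : BinaryTree Unit} (h : RootedSubtree t T) :
    ContainsPattern t T := by
  cases T with
  | nil => exact h
  | node a l r => exact Or.inl h

theorem avoidsPattern_node (t l r : BinaryTree Unit) (a : Unit) :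
    AvoidsPattern t (.node a l r) ↔
      ¬ RootedSubtree t (.node a l r) ∧ AvoidsPattern t l ∧ AvoidsPattern t r := by
  simp only [AvoidsPattern, ContainsPattern]
  tauto

/-- The finite set of trees with `n` leaves. -/
def treesWithLeaves : ℕ → Finset (BinaryTree Unit)
  | 0 => ∅
  | n + 1 => treesOfNumNodesEq n

theorem mem_treesWithLeaves {n : ℕ} {T : BinaryTree Unit} :
    T ∈ treesWithLeaves n ↔ T.numLeaves = n := by
  cases n with
  | zero => simpa [treesWithLeaves] using T.numLeaves_pos.ne'
  | succ n => simp [treesWithLeaves, mem_treesOfNumNodesEq, numLeaves_eq_numNodes_succ]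

open Classical in
/-- The trees with `n` leaves that avoid `t` and have `p` as a rooted subtree. -/
noncomputable def avoiders (t p : BinaryTree Unit) (n : ℕ) : Finset (BinaryTree Unit) :=
  (treesWithLeaves n).filter fun T => AvoidsPattern t T ∧ RootedSubtree p T

theorem mem_avoiders {t p T : BinaryTree Unit} {n : ℕ} :
    T ∈ avoiders t p n ↔ T.numLeaves = n ∧ AvoidsPattern t T ∧ RootedSubtree p T := by
  classical
  simp [avoiders, mem_treesWithLeaves]

/-- The generating function, by number of leaves, of the trees that avoid `t` and have `p` as a
rooted subtree. -/
noncomputable def avoiderSeries (t p : BinaryTree Unit) : ℚ⟦X⟧ :=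
  PowerSeries.mk fun n => ((avoiders t p n).card : ℚ)

theorem coeff_avoiderSeries (t p : BinaryTree Unit) (n : ℕ) :
    coeff n (avoiderSeries t p) = ((avoiders t p n).card : ℚ) := coeff_mk _ _

/-- Every tree has a leaf. The missing constant term is what makes the recursion contracting. -/
theorem constantCoeff_avoiderSeries (t p : BinaryTree Unit) :
    constantCoeff (avoiderSeries t p) = 0 := by
  rw [← coeff_zero_eq_constantCoeff_apply, coeff_avoiderSeries, Nat.cast_eq_zero,
    Finset.card_eq_zero]
  ext T
  simpa [mem_avoiders] using fun h => absurd h T.numLeaves_pos.ne'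

theorem avoiderSeries_eq_zero {t p : BinaryTree Unit} (h : RootedSubtree t p) :
    avoiderSeries t p = 0 := by
  ext n
  rw [coeff_avoiderSeries, map_zero, Nat.cast_eq_zero, Finset.card_eq_zero]
  ext T
  simp only [mem_avoiders, Finset.notMem_empty, iff_false, not_and]
  exact fun _ h1 h2 => h1 (containsPattern_of_rootedSubtree (rootedSubtree_trans h h2))

/-- The trees with `n` leaves whose two branches avoid `t` and have prescribed rooted subtrees. -/
noncomputable def grafts (t p q : BinaryTree Unit) (n : ℕ) : Finset (BinaryTree Unit) :=
  (Finset.HasAntidiagonal.antidiagonal n).biUnion fun ij =>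
    ((avoiders t p ij.1) ×ˢ (avoiders t q ij.2)).image fun lr => .node () lr.1 lr.2

theorem mem_grafts {t p q T : BinaryTree Unit} {n : ℕ} :
    T ∈ grafts t p q n ↔ ∃ l r, T = .node () l r ∧ T.numLeaves = n ∧
      (AvoidsPattern t l ∧ RootedSubtree p l) ∧ AvoidsPattern t r ∧ RootedSubtree q r := by
  simp only [grafts, Finset.mem_biUnion, Finset.HasAntidiagonal.mem_antidiagonal, Finset.mem_image,
    Finset.mem_product, mem_avoiders, Prod.exists]
  constructor
  · rintro ⟨i, j, hij, l, r, ⟨⟨h1, h2⟩, h3, h4⟩, rfl⟩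
    exact ⟨l, r, rfl, by simp [h1, h3, hij], h2, h4⟩
  · rintro ⟨l, r, rfl, h, h2, h4⟩
    exact ⟨l.numLeaves, r.numLeaves, h, l, r, ⟨⟨rfl, h2⟩, rfl, h4⟩, rfl⟩

theorem card_grafts (t p q : BinaryTree Unit) (n : ℕ) :
    ((grafts t p q n).card : ℚ) = coeff n (avoiderSeries t p * avoiderSeries t q) := by
  rw [grafts, Finset.card_biUnion, coeff_mul, Nat.cast_sum]
  · refine Finset.sum_congr rfl fun ij _ => ?_
    rw [Finset.card_image_of_injective, Finset.card_product, coeff_avoiderSeries,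
      coeff_avoiderSeries, Nat.cast_mul]
    rintro ⟨a, b⟩ ⟨c, d⟩ h
    simpa using h
  · rintro ⟨i, j⟩ _ ⟨i', j'⟩ _ hne
    rw [Function.onFun, Finset.disjoint_left]
    simp only [Finset.mem_image, Finset.mem_product, mem_avoiders, Prod.exists]
    rintro T ⟨l, r, ⟨⟨h1, -⟩, h2, -⟩, rfl⟩ ⟨l', r', ⟨⟨h1', -⟩, h2', -⟩, h⟩
    simp only [BinaryTree.node.injEq, true_and] at h
    apply hne
    rw [← h1, ← h2, ← h1', ← h2', h.1, h.2]

open Classical in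
/-- The fundamental recursion for the series of `t`-avoiding trees with a prescribed rooted
subtree. -/
theorem avoiderSeries_eq {t : BinaryTree Unit} (ht : t ≠ .nil) (p : BinaryTree Unit) :
    avoiderSeries t p = (if p = .nil then X else 0)
      + avoiderSeries t p.left * avoiderSeries t p.right
      - avoiderSeries t (union p t).left * avoiderSeries t (union p t).right := by
  rw [eq_sub_iff_add_eq]
  ext n
  have hu : ∀ T : BinaryTree Unit, RootedSubtree (union p t) T ↔ RootedSubtree p T ∧
    RootedSubtree t T := rootedSubtree_union p t
  -- A tree with p at its root and with t-avoiding branches either avoids t or has t at its root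
  -- too. The latter trees are the grafts for p ∪ t, which is not `nil` because t is not; the single
  -- leaf is the only tree that is no graft.
  have key : avoiders t p n ∪ grafts t (union p t).left (union p t).right n
      = (if p = .nil ∧ n = 1 then {.nil} else ∅) ∪ grafts t p.left p.right n := by
    ext T
    simp only [Finset.mem_union, mem_avoiders, mem_grafts]
    cases T with
    | nil =>
      have h1 : AvoidsPattern t .nil := by
        cases t with
        | nil => exact absurd rfl ht
        | node => exact fun h => h
      have h2 : RootedSubtree p .nil ↔ p = .nil := by
        cases p <;> simp [RootedSubtree]
      split_ifs with h <;> simp only [numLeaves, h1, h2] <;> grind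
    | node a l r =>
      have h1 := hu (.node a l r)
      have h0 : ∀ s : BinaryTree Unit, (∃ l' r', BinaryTree.node a l r = .node () l' r' ∧
        (BinaryTree.node a l r).numLeaves = n ∧ (AvoidsPattern t l' ∧ RootedSubtree s.left l') ∧
          AvoidsPattern t r' ∧ RootedSubtree s.right r') ↔
        ((BinaryTree.node a l r).numLeaves = n ∧ AvoidsPattern t l ∧ AvoidsPattern t r ∧
          RootedSubtree s (.node a l r)) := by
        intro s
        rw [rootedSubtree_node]
        constructor
        · rintro ⟨l', r', h, h2, h3⟩
          simp only [BinaryTree.node.injEq, true_and] at h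
          obtain ⟨rfl, rfl⟩ := h
          tauto
        · rintro ⟨h2, h3⟩
          exact ⟨l, r, rfl, h2, by tauto⟩
      have h3 : BinaryTree.node a l r ∉ (if p = .nil ∧ n = 1 then {.nil} else ∅ :
          Finset (BinaryTree Unit)) := by
        split_ifs <;> simp
      rw [h0, h0, h1, avoidsPattern_node]
      tauto
  have d1 : Disjoint (avoiders t p n) (grafts t (union p t).left (union p t).right n) := by
    rw [Finset.disjoint_left]
    intro T h1 h2
    rw [mem_avoiders] at h1
    rw [mem_grafts] at h2
    obtain ⟨l, r, rfl, -, h3, h4⟩ := h2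
    have h5 := (hu _).1 ((rootedSubtree_node (union p t) l r ()).2 ⟨h3.2, h4.2⟩)
    exact h1.2.1 (containsPattern_of_rootedSubtree h5.2)
  have d2 : Disjoint (if p = .nil ∧ n = 1 then {.nil} else ∅ : Finset (BinaryTree Unit))
      (grafts t p.left p.right n) := by
    rw [Finset.disjoint_left]
    intro T h1 h2
    rw [mem_grafts] at h2
    obtain ⟨l, r, rfl, -⟩ := h2
    split_ifs at h1 <;> simp at h1
  have := congrArg (fun s : Finset (BinaryTree Unit) => (s.card : ℚ)) key
  simp only [Finset.card_union_of_disjoint d1, Finset.card_union_of_disjoint d2, Nat.cast_add,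
    card_grafts] at this
  rw [map_add, map_add, coeff_avoiderSeries, this]
  congr 1
  by_cases hp : p = .nil <;> by_cases hn : n = 1 <;> simp [hp, hn, coeff_X]

/-- Approximate solutions of the fundamental recursion on a closed set of trees are unique. -/
theorem dvd_sub_avoiderSeries {t : BinaryTree Unit} (ht : t ≠ .nil) (S : Set (BinaryTree Unit))
    (W : BinaryTree Unit → ℚ⟦X⟧) (L : ℕ)
    (hS : ∀ p ∈ S, (RootedSubtree t p ∧ W p = 0) ∨
      (p.left ∈ S ∧ p.right ∈ S ∧ (union p t).left ∈ S ∧ (union p t).right ∈ S ∧ X ∣ W p ∧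
        X ^ L ∣ W p - ((open Classical in if p = .nil then X else 0) + W p.left * W p.right
          - W (union p t).left * W (union p t).right))) :
    ∀ p ∈ S, X ^ L ∣ W p - avoiderSeries t p := by
  have hX : ∀ p, X ∣ avoiderSeries t p := fun p =>
    X_dvd_iff.2 (constantCoeff_avoiderSeries t p)
  have hW : ∀ p ∈ S, X ∣ W p := by
    intro p hp
    rcases hS p hp with h | h
    · exact h.2 ▸ dvd_zero _
    · exact h.2.2.2.2.1
  -- Both factors are divisible by X, so an error of order n in the factors becomes one of order n +
  -- 1 in the product: each pass through the recursion gains one coefficient.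
  have hmul : ∀ n, ∀ a b, a ∈ S → b ∈ S → X ^ n ∣ W a - avoiderSeries t a →
      X ^ n ∣ W b - avoiderSeries t b →
      X ^ (n + 1) ∣ W a * W b - avoiderSeries t a * avoiderSeries t b := by
    intro n a b ha hb h1 h2
    have e : W a * W b - avoiderSeries t a * avoiderSeries t b
        = (W b - avoiderSeries t b) * W a + (W a - avoiderSeries t a) * avoiderSeries t b := by ring
    rw [e, pow_succ]
    exact dvd_add (mul_dvd_mul h2 (hW a ha)) (mul_dvd_mul h1 (hX b))
  suffices ∀ n ≤ L, ∀ p ∈ S, X ^ n ∣ W p - avoiderSeries t p from this L le_rfl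
  intro n
  induction n with
  | zero => simp
  | succ n ih =>
    intro hn p hp
    rcases hS p hp with h | ⟨h1, h2, h3, h4, -, h5⟩
    · rw [h.2, avoiderSeries_eq_zero h.1, sub_zero]
      exact dvd_zero _
    · have ih := ih (by omega)
      have e := avoiderSeries_eq ht p
      have a1 := hmul n _ _ h1 h2 (ih _ h1) (ih _ h2)
      have a2 := hmul n _ _ h3 h4 (ih _ h3) (ih _ h4)
      have a3 := (pow_dvd_pow (X : ℚ⟦X⟧) hn).trans h5
      have a4 := dvd_add a3 (dvd_sub a1 a2)
      convert a4 using 1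
      rw [e]
      ring

/-! ### Reflection symmetry -/

/-- Reflection of a tree. -/
def mirror : BinaryTree Unit → BinaryTree Unit
  | .nil => .nil
  | .node a l r => .node a (mirror r) (mirror l)

theorem mirror_mirror (T : BinaryTree Unit) : mirror (mirror T) = T := by
  induction T with
  | nil => rfl
  | node a l r hl hr => simp [mirror, hl, hr]

theorem numLeaves_mirror (T : BinaryTree Unit) : (mirror T).numLeaves = T.numLeaves := by
  induction T with
  | nil => rfl
  | node a l r hl hr => simp [mirror, hl, hr, add_comm]

theorem rootedSubtree_mirror (t T : BinaryTree Unit) :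
    RootedSubtree (mirror t) (mirror T) ↔ RootedSubtree t T := by
  induction t generalizing T with
  | nil => simp [mirror, rootedSubtree_nil]
  | node a l r hl hr =>
    cases T with
    | nil => rfl
    | node b l' r' =>
      simp only [mirror, RootedSubtree, hl, hr]
      tauto

theorem containsPattern_mirror (t T : BinaryTree Unit) :
    ContainsPattern (mirror t) (mirror T) ↔ ContainsPattern t T := by
  induction T with
  | nil => exact rootedSubtree_mirror t .nil
  | node a l r hl hr =>
    have := rootedSubtree_mirror t (.node a l r)
    simp only [mirror] at this
    simp only [mirror, ContainsPattern, hl, hr, this]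
    tauto

/-- Reflection is an involution preserving leaves and containment, so it matches the avoiders of t
with those of its mirror image. -/
theorem avoiderSeries_mirror (t : BinaryTree Unit) :
    avoiderSeries (mirror t) .nil = avoiderSeries t .nil := by
  ext n
  rw [coeff_avoiderSeries, coeff_avoiderSeries, Nat.cast_inj]
  have key : ∀ t T : BinaryTree Unit,
      T ∈ avoiders t .nil n → mirror T ∈ avoiders (mirror t) .nil n := by
    intro t T hT
    simp only [mem_avoiders, numLeaves_mirror, AvoidsPattern, rootedSubtree_nil, and_true,
      containsPattern_mirror] at hT ⊢
    exact hT
  exact Finset.card_nbij' mirror mirror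
    (fun T hT => by simpa only [mirror_mirror, Finset.mem_coe] using key (mirror t) T hT)
    (fun T hT => key t T hT) (fun T _ => mirror_mirror T) (fun T _ => mirror_mirror T)

/-! ### Counting by vertices and counting by leaves -/

theorem ncard_numVertices (t : BinaryTree Unit) (n : ℕ) :
    {T | numVertices T = 2 * n + 1 ∧ AvoidsPattern t T}.ncard = (avoiders t .nil (n + 1)).card := by
  rw [← Set.ncard_coe_finset]
  congr 1
  ext T
  have := numLeaves_eq_numNodes_succ T
  simp only [Set.mem_ofPred_eq, Finset.mem_coe, mem_avoiders, rootedSubtree_nil, and_true,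
    numVertices]
  constructor <;> rintro ⟨h1, h2⟩ <;> exact ⟨by omega, h2⟩

/-- The avoidance function and the series counting avoiders by leaves determine each other. -/
theorem wilfEquivalent_iff (s t : BinaryTree Unit) :
    WilfEquivalent s t ↔ avoiderSeries s .nil = avoiderSeries t .nil := by
  simp only [WilfEquivalent, avoidanceSeries, avoiderSeries, PowerSeries.ext_iff, coeff_mk,
    Nat.cast_inj]
  constructor
  · intro h n
    cases n with
    | zero => rfl
    | succ n => rw [← ncard_numVertices, ← ncard_numVertices, h]
  · intro h n
    obtain ⟨k, rfl | rfl⟩ := Nat.even_or_odd' n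
    -- A tree with k internal vertices has k + 1 leaves, so its number of vertices is odd and the
    -- even coefficients vanish.
    · have e : ∀ t : BinaryTree Unit, {T | numVertices T = 2 * k ∧ AvoidsPattern t T} = ∅ := by
        intro t
        ext T
        have := numLeaves_eq_numNodes_succ T
        simp only [numVertices, Set.mem_ofPred_eq, Set.mem_empty_iff_false, iff_false]
        omega
      rw [e, e]
    · rw [ncard_numVertices, ncard_numVertices, h]

end PatternAvoidance

namespace PatternAvoidance

/-! ### Polynomials as coefficient lists -/

section ListPoly

variable {α R : Type*}

/-- Sum of two polynomials given by their coefficient lists, lowest degree first. -/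
def polyAdd (add : α → α → α) : List α → List α → List α
  | [], g => g
  | a :: f, [] => a :: f
  | a :: f, b :: g => add a b :: polyAdd add f g

/-- Product of two polynomials given by their coefficient lists. -/
def polyMul (add mul : α → α → α) (zero : α) : List α → List α → List α
  | [], _ => []
  | a :: f, g => polyAdd add (g.map (mul a)) (zero :: polyMul add mul zero f g)

variable [CommRing R] (φ : α → R) (x : R)

/-- Value at `x` of the polynomial with the given coefficient list, the coefficients being
interpreted by `φ`. -/
def polyEval : List α → R
  | [] => 0
  | a :: f => φ a + x * polyEval f

/-- The coefficient type and its operations are parameters so that one proof serves integer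
coefficients and, a level higher, coefficients that are themselves polynomials in b. -/
theorem polyEval_add {add : α → α → α} (h : ∀ a b, φ (add a b) = φ a + φ b) (f g : List α) :
    polyEval φ x (polyAdd add f g) = polyEval φ x f + polyEval φ x g := by
  induction f generalizing g with
  | nil => simp [polyAdd, polyEval]
  | cons a f ih =>
    cases g with
    | nil => simp [polyAdd, polyEval]
    | cons b g =>
      simp only [polyAdd, polyEval, h, ih]
      ring

theorem polyEval_map {c : R} {m : α → α} (h : ∀ a, φ (m a) = c * φ a) (f : List α) :
    polyEval φ x (f.map m) = c * polyEval φ x f := by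
  induction f with
  | nil => simp [polyEval]
  | cons a f ih =>
    simp only [List.map_cons, polyEval, h, ih]
    ring

theorem polyEval_mul {add mul : α → α → α} {zero : α} (h : ∀ a b, φ (add a b) = φ a + φ b)
    (h' : ∀ a b, φ (mul a b) = φ a * φ b) (h0 : φ zero = 0) (f g : List α) :
    polyEval φ x (polyMul add mul zero f g) = polyEval φ x f * polyEval φ x g := by
  induction f with
  | nil => simp [polyMul, polyEval]
  | cons a f ih =>
    rw [polyMul, polyEval_add φ x h, polyEval_map φ x (h' a)]
    simp only [polyEval, h0, ih]
    ring

end ListPoly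

/-- Univariate integer polynomials: sum. -/
def uadd : List ℤ → List ℤ → List ℤ := polyAdd Int.add

/-- Univariate integer polynomials: product. -/
def umul : List ℤ → List ℤ → List ℤ := polyMul Int.add Int.mul 0

/-- Univariate integer polynomials: multiplication by a constant. -/
def uscale (c : ℤ) (f : List ℤ) : List ℤ := f.map (Int.mul c)

/-- Univariate integer polynomials: vanishing. -/
def uzero (f : List ℤ) : Bool := f.all fun c => decide (c = 0)

/-- Bivariate integer polynomials, as polynomials in `x` with coefficients in `ℤ[b]`: sum. -/
def badd : List (List ℤ) → List (List ℤ) → List (List ℤ) := polyAdd uadd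

/-- Bivariate integer polynomials: product. -/
def bmul : List (List ℤ) → List (List ℤ) → List (List ℤ) := polyMul uadd umul []

/-- Bivariate integer polynomials: multiplication by a constant. -/
def bscale (c : ℤ) (f : List (List ℤ)) : List (List ℤ) := f.map (uscale c)

/-- Bivariate integer polynomials: vanishing. -/
def bzero (f : List (List ℤ)) : Bool := f.all uzero

section Eval

variable {R : Type*} [CommRing R] (b x : R)

/-- Evaluation of a univariate integer polynomial. -/
def ueval : List ℤ → R := polyEval (fun c : ℤ => (c : R)) b

/-- Evaluation of a bivariate integer polynomial. -/
def beval : List (List ℤ) → R := polyEval (ueval b) x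

@[simp] theorem ueval_nil : ueval b [] = 0 := rfl

@[simp] theorem ueval_cons (c : ℤ) (f : List ℤ) : ueval b (c :: f) = c + b * ueval b f := rfl

@[simp] theorem beval_nil : beval b x [] = 0 := rfl

@[simp] theorem beval_cons (c : List ℤ) (f : List (List ℤ)) :
    beval b x (c :: f) = ueval b c + x * beval b x f := rfl

theorem ueval_add (f g : List ℤ) : ueval b (uadd f g) = ueval b f + ueval b g :=
  polyEval_add _ _ Int.cast_add _ _

theorem ueval_mul (f g : List ℤ) : ueval b (umul f g) = ueval b f * ueval b g :=
  polyEval_mul _ _ Int.cast_add Int.cast_mul Int.cast_zero _ _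

theorem ueval_scale (c : ℤ) (f : List ℤ) : ueval b (uscale c f) = c * ueval b f :=
  polyEval_map _ _ (Int.cast_mul c) _

theorem ueval_eq_zero {f : List ℤ} (h : uzero f = true) : ueval b f = 0 := by
  induction f with
  | nil => rfl
  | cons a f ih =>
    simp only [uzero, List.all_cons, Bool.and_eq_true, decide_eq_true_eq] at h
    rw [ueval_cons, h.1, ih h.2]
    simp

theorem beval_add (f g : List (List ℤ)) : beval b x (badd f g) = beval b x f + beval b x g :=
  polyEval_add _ _ (ueval_add b) _ _

theorem beval_mul (f g : List (List ℤ)) : beval b x (bmul f g) = beval b x f * beval b x g :=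
  polyEval_mul _ _ (ueval_add b) (ueval_mul b) rfl _ _

theorem beval_scale (c : ℤ) (f : List (List ℤ)) : beval b x (bscale c f) = c * beval b x f :=
  polyEval_map _ _ (ueval_scale b c) _

theorem beval_eq_zero {f : List (List ℤ)} (h : bzero f = true) : beval b x f = 0 := by
  induction f with
  | nil => rfl
  | cons a f ih =>
    simp only [bzero, List.all_cons, Bool.and_eq_true] at h
    rw [beval_cons, ueval_eq_zero b h.1, ih h.2]
    simp

end Eval

/-! ### Derivatives -/

/-- Derivative of a univariate polynomial. -/
def uderiv : List ℤ → List ℤ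
  | [] => []
  -- Product rule: (c + b f)' = f + b f'.
  | _ :: f => uadd f (0 :: uderiv f)

/-- Derivative of a bivariate polynomial with respect to `b`. -/
def bderiv (F : List (List ℤ)) : List (List ℤ) := F.map uderiv

section Taylor

variable {R : Type*} [CommRing R] (b x h : R)

theorem dvd_ueval_add_sub (f : List ℤ) : h ∣ ueval (b + h) f - ueval b f := by
  induction f with
  | nil => simp
  | cons c f ih =>
    obtain ⟨d, hd⟩ := ih
    exact ⟨b * d + ueval (b + h) f, by simp only [ueval_cons]; linear_combination b * hd⟩

theorem dvd_beval_add_sub (F : List (List ℤ)) : h ∣ beval (b + h) x F - beval b x F := by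
  induction F with
  | nil => simp
  | cons f F ih =>
    have e : beval (b + h) x (f :: F) - beval b x (f :: F)
        = (ueval (b + h) f - ueval b f) + x * (beval (b + h) x F - beval b x F) := by
      simp only [beval_cons]
      ring
    rw [e]
    exact dvd_add (dvd_ueval_add_sub b h f) (ih.mul_left x)

/-- Taylor's formula, the source of the Newton step in `exists_root`. Since (b + h) f(b + h) = b f(b
+ h) + h f(b + h), the inductive step needs the second-order estimate for f multiplied by b and the
first-order one multiplied by h. -/
theorem sq_dvd_ueval_add (f : List ℤ) :
    h ^ 2 ∣ ueval (b + h) f - ueval b f - ueval b (uderiv f) * h := by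
  induction f with
  | nil => simp [uderiv]
  | cons c f ih =>
    obtain ⟨d, hd⟩ := ih
    obtain ⟨e, he⟩ := dvd_ueval_add_sub b h f
    refine ⟨b * d + e, ?_⟩
    simp only [ueval_cons, uderiv, ueval_add, Int.cast_zero]
    linear_combination b * hd + h * he

theorem sq_dvd_beval_add (F : List (List ℤ)) :
    h ^ 2 ∣ beval (b + h) x F - beval b x F - beval b x (bderiv F) * h := by
  induction F with
  | nil => simp [bderiv]
  | cons f F ih =>
    have e : beval (b + h) x (f :: F) - beval b x (f :: F) - beval b x (bderiv (f :: F)) * h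
        = (ueval (b + h) f - ueval b f - ueval b (uderiv f) * h)
          + x * (beval (b + h) x F - beval b x F - beval b x (bderiv F) * h) := by
      simp only [beval_cons, bderiv, List.map_cons]
      ring
    rw [e]
    exact dvd_add (sq_dvd_ueval_add b h f) (ih.mul_left x)

end Taylor

/-! ### Truncated power series -/

open PowerSeries (X C coeff constantCoeff)

/-- Product of truncated series. -/
def tmul (L : ℕ) (f g : List ℤ) : List ℤ := (umul f g).take L

/-- Truncation of `f(b)`, where `b` is a truncated series. -/
def utrunc (L : ℕ) (b : List ℤ) : List ℤ → List ℤ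
  | [] => []
  | c :: f => uadd [c] (tmul L b (utrunc L b f))

/-- Truncation of `F(b, X)`, where `b` is a truncated series. -/
def btrunc (L : ℕ) (b : List ℤ) : List (List ℤ) → List ℤ
  | [] => []
  | f :: F => (uadd (utrunc L b f) (0 :: btrunc L b F)).take L

theorem X_pow_dvd_ueval_sub_take (L : ℕ) (f : List ℤ) :
    (X : ℚ⟦X⟧) ^ L ∣ ueval X f - ueval X (f.take L) := by
  induction L generalizing f with
  | zero => simp
  | succ L ih =>
    cases f with
    | nil => simp
    | cons c f =>
      have e : ueval (X : ℚ⟦X⟧) (c :: f) - ueval X ((c :: f).take (L + 1))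
          = X * (ueval X f - ueval X (f.take L)) := by
        simp only [List.take_succ_cons, ueval_cons]
        ring
      rw [e, pow_succ']
      exact mul_dvd_mul_left X (ih f)

theorem dvd_mul_sub_mul {R : Type*} [CommRing R] {d a a' b b' : R} (h : d ∣ a - a')
    (h' : d ∣ b - b') : d ∣ a * b - a' * b' := by
  have e : a * b - a' * b' = (a - a') * b + a' * (b - b') := by ring
  rw [e]
  exact dvd_add (h.mul_right b) (h'.mul_left a')

theorem X_pow_dvd_mul_sub_tmul {L : ℕ} {f g : List ℤ} {β γ : ℚ⟦X⟧} (h : X ^ L ∣ β - ueval X f)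
    (h' : X ^ L ∣ γ - ueval X g) : X ^ L ∣ β * γ - ueval X (tmul L f g) := by
  have h1 := dvd_mul_sub_mul h h'
  have h2 := X_pow_dvd_ueval_sub_take L (umul f g)
  rw [ueval_mul] at h2
  have := dvd_add h1 h2
  rwa [sub_add_sub_cancel] at this

theorem X_pow_dvd_ueval_sub_utrunc {L : ℕ} {b : List ℤ} {β : ℚ⟦X⟧} (h : X ^ L ∣ β - ueval X b)
    (f : List ℤ) : X ^ L ∣ ueval β f - ueval X (utrunc L b f) := by
  induction f with
  | nil => simp [utrunc]
  | cons c f ih =>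
    have := X_pow_dvd_mul_sub_tmul h ih
    simpa [utrunc, ueval_add] using this

/-- A computation with finitely many integers controls F(β, X) for a series β of which only L
coefficients are known. -/
theorem X_pow_dvd_beval_sub_btrunc {L : ℕ} {b : List ℤ} {β : ℚ⟦X⟧} (h : X ^ L ∣ β - ueval X b)
    (F : List (List ℤ)) : X ^ L ∣ beval β X F - ueval X (btrunc L b F) := by
  induction F with
  | nil => simp [btrunc]
  | cons f F ih =>
    have h1 := X_pow_dvd_ueval_sub_utrunc h f
    have h2 := X_pow_dvd_ueval_sub_take L (uadd (utrunc L b f) (0 :: btrunc L b F))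
    have h3 := dvd_add (dvd_add h1 (ih.mul_left X)) h2
    convert h3 using 1
    simp only [btrunc, beval_cons, ueval_add, ueval_cons, Int.cast_zero]
    ring

/-- The first `k` coefficients vanish. -/
def lowZero (k : ℕ) (f : List ℤ) : Bool := uzero (f.take k)

theorem X_pow_dvd_ueval_of_lowZero {k : ℕ} {f : List ℤ} (h : lowZero k f = true) :
    (X : ℚ⟦X⟧) ^ k ∣ ueval X f := by
  have := X_pow_dvd_ueval_sub_take k f
  rwa [ueval_eq_zero _ h, sub_zero] at this

/-- The order of the truncated series is exactly `k`. -/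
def hasOrder (k : ℕ) (f : List ℤ) : Bool := lowZero k f && decide (f.getD k 0 ≠ 0)

theorem ueval_eq_take_add_drop {R : Type*} [CommRing R] (x : R) (k : ℕ) (f : List ℤ) :
    ueval x f = ueval x (f.take k) + x ^ k * ueval x (f.drop k) := by
  induction k generalizing f with
  | zero => simp
  | succ k ih =>
    cases f with
    | nil => simp
    | cons c f =>
      simp only [List.take_succ_cons, List.drop_succ_cons, ueval_cons]
      rw [ih f]
      ring

theorem constantCoeff_ueval_X (f : List ℤ) :
    constantCoeff (ueval (X : ℚ⟦X⟧) f) = ((f.getD 0 0 : ℤ) : ℚ) := by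
  cases f with
  | nil => simp
  | cons c f => simp

/-- Because k < L, the unknown part of β cannot touch the coefficient of X^k, so the order read off
from the truncation is the true one. -/
theorem exists_eq_X_pow_mul_of_hasOrder {k L : ℕ} {f : List ℤ} {β : ℚ⟦X⟧}
    (h : hasOrder k f = true) (hk : k < L) (hβ : X ^ L ∣ β - ueval X f) :
    ∃ w : ℚ⟦X⟧, constantCoeff w ≠ 0 ∧ β = X ^ k * w := by
  simp only [hasOrder, Bool.and_eq_true, decide_eq_true_eq] at h
  obtain ⟨h1, h2⟩ := h
  obtain ⟨γ, hγ⟩ := hβ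
  refine ⟨ueval X (f.drop k) + X ^ (L - k) * γ, ?_, ?_⟩
  · have e : (f.drop k).getD 0 0 = f.getD k 0 := by simp [List.getD]
    rw [map_add, constantCoeff_ueval_X, e]
    have : L - k ≠ 0 := by omega
    simpa [this] using h2
  · have e := ueval_eq_take_add_drop (X : ℚ⟦X⟧) k f
    rw [ueval_eq_zero _ h1] at e
    have : (X : ℚ⟦X⟧) ^ L = X ^ k * X ^ (L - k) := by rw [← pow_add]; congr 1; omega
    linear_combination hγ + e + γ * this

/-! ### Roots of polynomials in power series -/

theorem eq_zero_of_forall_X_pow_dvd {f : ℚ⟦X⟧} (h : ∀ n : ℕ, X ^ n ∣ f) : f = 0 := by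
  ext n
  exact (PowerSeries.X_pow_dvd_iff.1 (h (n + 1))) n (Nat.lt_succ_self n)

/-- Limits of `X`-adically convergent sequences. -/
theorem exists_limit (m : ℕ) (s : ℕ → ℚ⟦X⟧) (h : ∀ n, X ^ (m + n) ∣ s (n + 1) - s n) :
    ∃ β : ℚ⟦X⟧, ∀ n, X ^ (m + n) ∣ β - s n := by
  have h' : ∀ n d, X ^ (m + n) ∣ s (n + d) - s n := by
    intro n d
    induction d with
    | zero => simp
    | succ d ih =>
      have := dvd_add ((pow_dvd_pow (X : ℚ⟦X⟧) (show m + n ≤ m + (n + d) by omega)).trans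
        (h (n + d))) ih
      rwa [sub_add_sub_cancel] at this
  -- The sequence is constant modulo X^(m + n) from index n on; since j < m + (j + 1), the
  -- coefficient of X^j no longer changes after index j + 1.
  refine ⟨PowerSeries.mk fun j => coeff j (s (j + 1)), fun n => ?_⟩
  rw [PowerSeries.X_pow_dvd_iff]
  intro j hj
  rw [map_sub, PowerSeries.coeff_mk, sub_eq_zero]
  rcases le_total n (j + 1) with hn | hn
  · obtain ⟨d, hd⟩ := Nat.exists_eq_add_of_le hn
    have := PowerSeries.X_pow_dvd_iff.1 (h' n d) j hj
    rwa [map_sub, sub_eq_zero, ← hd] at this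
  · obtain ⟨d, rfl⟩ := Nat.exists_eq_add_of_le hn
    have := PowerSeries.X_pow_dvd_iff.1 (h' (j + 1) d) j (by omega)
    rw [map_sub, sub_eq_zero] at this
    exact this.symm

/-- Hensel's lemma for power series. -/
theorem exists_root (F : List (List ℤ)) (b w : ℚ⟦X⟧) {k m : ℕ} (hk : k < m)
    (h : X ^ (m + k) ∣ beval b X F) (hw : constantCoeff w ≠ 0)
    (h' : beval b X (bderiv F) = X ^ k * w) :
    ∃ β : ℚ⟦X⟧, X ^ m ∣ β - b ∧ beval β X F = 0 := by
  have step : ∀ (n : ℕ) (a : ℚ⟦X⟧), X ^ m ∣ a - b → X ^ (m + n + k) ∣ beval a X F →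
      ∃ a', X ^ m ∣ a' - b ∧ X ^ (m + (n + 1) + k) ∣ beval a' X F ∧ X ^ (m + n) ∣ a' - a := by
    intro n a ha ⟨g, hg⟩
    obtain ⟨d, hd⟩ := dvd_beval_add_sub b X (a - b) (bderiv F)
    obtain ⟨e, he⟩ := ha
    rw [add_sub_cancel, h', he] at hd
    have hm : (X : ℚ⟦X⟧) ^ m = X ^ k * X ^ (m - k) := by rw [← pow_add]; congr 1; omega
    -- The derivative at a still has order exactly k: a and b differ by a multiple of X^m with m >
    -- k, so its cofactor w' has the constant term of w.
    set w' := w + X ^ (m - k) * e * d with hw'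
    have hw0 : constantCoeff w' = constantCoeff w := by
      have : m - k ≠ 0 := by omega
      simp [hw', this]
    have hd' : beval a X (bderiv F) = X ^ k * w' := by
      rw [hw']
      linear_combination hd + e * d * hm
    -- Newton correction: c is chosen so that the linear term X^(m + n) c · X^k w' cancels the
    -- lowest coefficient of F(a) = X^(m + n + k) g.
    set c : ℚ := -(constantCoeff g) / constantCoeff w with hc
    obtain ⟨y, hy⟩ := sq_dvd_beval_add a X (X ^ (m + n) * C c) F
    have hz : X ∣ g + C c * w' := by
      rw [PowerSeries.X_dvd_iff, map_add, map_mul, hw0, PowerSeries.constantCoeff_C, hc]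
      field_simp
      ring
    obtain ⟨z, hz⟩ := hz
    refine ⟨a + X ^ (m + n) * C c, ?_, ?_, ?_⟩
    · have e1 : a + X ^ (m + n) * C c - b = (a - b) + X ^ m * (X ^ n * C c) := by ring
      rw [e1, he]
      exact dvd_add (dvd_mul_right _ _) (dvd_mul_right _ _)
    -- The quadratic Taylor term is divisible by X^(2 (m + n)), and 2 (m + n) ≥ m + n + k + 1
    -- because k < m.
    · have e1 : beval (a + X ^ (m + n) * C c) X F
          = X ^ (m + (n + 1) + k) * (z + X ^ (m + n - k - 1) * (C c ^ 2 * y)) := by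
        have e2 : (X : ℚ⟦X⟧) ^ (m + n) = X ^ k * X * X ^ (m + n - k - 1) := by
          rw [← pow_succ, ← pow_add]; congr 1; omega
        rw [hg, hd'] at hy
        have e3 : (X : ℚ⟦X⟧) ^ (m + n + k) = X ^ (m + n) * X ^ k := by rw [pow_add]
        have e4 : (X : ℚ⟦X⟧) ^ (m + (n + 1) + k) = X ^ (m + n) * X ^ k * X := by ring
        rw [e4]
        linear_combination hy + X ^ (m + n) * X ^ k * hz + g * e3
          + X ^ (m + n) * C c ^ 2 * y * e2
      rw [e1]
      exact dvd_mul_right _ _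
    · rw [add_sub_cancel_left]
      exact dvd_mul_right _ _
  choose! f hf using step
  let s : ℕ → ℚ⟦X⟧ := fun n => Nat.rec b (fun n a => f n a) n
  have hs : ∀ n, X ^ m ∣ s n - b ∧ X ^ (m + n + k) ∣ beval (s n) X F := by
    intro n
    induction n with
    | zero => exact ⟨by simp [s], h⟩
    | succ n ih => exact ⟨(hf n (s n) ih.1 ih.2).1, (hf n (s n) ih.1 ih.2).2.1⟩
  obtain ⟨β, hβ⟩ := exists_limit m s fun n => (hf n (s n) (hs n).1 (hs n).2).2.2
  refine ⟨β, hβ 0, eq_zero_of_forall_X_pow_dvd fun n => ?_⟩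
  have h1 := dvd_beval_add_sub (s n) X (β - s n) F
  rw [add_sub_cancel] at h1
  have h2 := ((pow_dvd_pow (X : ℚ⟦X⟧) (show n ≤ m + n by omega)).trans (hβ n)).trans h1
  have h3 := (pow_dvd_pow (X : ℚ⟦X⟧) (show n ≤ m + n + k by omega)).trans (hs n).2
  have := dvd_add h2 h3
  rwa [sub_add_cancel] at this

end PatternAvoidance

namespace PatternAvoidance

open PowerSeries (X C coeff constantCoeff)

/-! ### Size of polynomials given by coefficient lists -/

section Size

variable {α : Type*}

/-- Sum of the sizes of the coefficients. -/
def polyNorm (ν : α → ℕ) : List α → ℕ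
  | [] => 0
  | a :: f => ν a + polyNorm ν f

/-- Maximum of the sizes of the coefficients. -/
def polyMax (ν : α → ℕ) : List α → ℕ
  | [] => 0
  | a :: f => max (ν a) (polyMax ν f)

variable {ν : α → ℕ} {add mul : α → α → α} {zero : α}

theorem polyNorm_add (h : ∀ a b, ν (add a b) ≤ ν a + ν b) (f g : List α) :
    polyNorm ν (polyAdd add f g) ≤ polyNorm ν f + polyNorm ν g := by
  induction f generalizing g with
  | nil => simp [polyAdd, polyNorm]
  | cons a f ih =>
    cases g with
    | nil => simp [polyAdd, polyNorm]
    | cons b g =>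
      have := ih g
      have := h a b
      simp only [polyAdd, polyNorm]
      omega

theorem polyNorm_map {c : ℕ} {m : α → α} (h : ∀ a, ν (m a) ≤ c * ν a) (f : List α) :
    polyNorm ν (f.map m) ≤ c * polyNorm ν f := by
  induction f with
  | nil => simp [polyNorm]
  | cons a f ih =>
    simp only [List.map_cons, polyNorm, mul_add]
    exact add_le_add (h a) ih

/-- With this the size of a product is bounded from the sizes of the factors, without multiplying
out. -/
theorem polyNorm_mul (h : ∀ a b, ν (add a b) ≤ ν a + ν b) (h' : ∀ a b, ν (mul a b) ≤ ν a * ν b)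
    (h0 : ν zero = 0) (f g : List α) :
    polyNorm ν (polyMul add mul zero f g) ≤ polyNorm ν f * polyNorm ν g := by
  induction f with
  | nil => simp [polyMul, polyNorm]
  | cons a f ih =>
    refine (polyNorm_add h _ _).trans ?_
    simp only [polyNorm, h0, zero_add, add_mul]
    exact add_le_add (polyNorm_map (h' a) g) ih

theorem polyMax_add (h : ∀ a b, ν (add a b) ≤ max (ν a) (ν b)) (f g : List α) :
    polyMax ν (polyAdd add f g) ≤ max (polyMax ν f) (polyMax ν g) := by
  induction f generalizing g with
  | nil => simp [polyAdd, polyMax]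
  | cons a f ih =>
    cases g with
    | nil => simp [polyAdd, polyMax]
    | cons b g =>
      have := ih g
      have := h a b
      simp only [polyAdd, polyMax]
      omega

theorem polyMax_map {c : ℕ} {m : α → α} (h : ∀ a, ν (m a) ≤ c + ν a) (f : List α) :
    polyMax ν (f.map m) ≤ c + polyMax ν f := by
  induction f with
  | nil => simp [polyMax]
  | cons a f ih =>
    have := h a
    simp only [List.map_cons, polyMax]
    omega

theorem polyMax_mul (h : ∀ a b, ν (add a b) ≤ max (ν a) (ν b))
    (h' : ∀ a b, ν (mul a b) ≤ ν a + ν b) (h0 : ν zero = 0) (f g : List α) :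
    polyMax ν (polyMul add mul zero f g) ≤ polyMax ν f + polyMax ν g := by
  induction f with
  | nil => simp [polyMul, polyMax]
  | cons a f ih =>
    refine (polyMax_add h _ _).trans ?_
    have := polyMax_map (h' a) g
    simp only [polyMax, h0]
    omega

theorem length_polyAdd (f g : List α) : (polyAdd add f g).length = max f.length g.length := by
  induction f generalizing g with
  | nil => simp [polyAdd]
  | cons a f ih => cases g <;> simp [polyAdd, ih]

theorem length_polyMul_le (f g : List α) :
    (polyMul add mul zero f g).length ≤ f.length + g.length := by
  induction f with
  | nil => simp [polyMul]
  | cons a f ih =>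
    rw [polyMul, length_polyAdd, List.length_map, List.length_cons, List.length_cons]
    omega

end Size

/-- Sum of the absolute values of the coefficients. -/
def unorm : List ℤ → ℕ := polyNorm Int.natAbs

/-- Sum of the absolute values of the coefficients. -/
def bnorm : List (List ℤ) → ℕ := polyNorm unorm

/-- Strict upper bound for the degree in `b`. -/
def bwidth : List (List ℤ) → ℕ := polyMax List.length

theorem unorm_add (f g : List ℤ) : unorm (uadd f g) ≤ unorm f + unorm g :=
  polyNorm_add Int.natAbs_add_le f g

theorem unorm_mul (f g : List ℤ) : unorm (umul f g) ≤ unorm f * unorm g :=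
  polyNorm_mul Int.natAbs_add_le (fun a b => (Int.natAbs_mul a b).le) rfl f g

theorem unorm_scale (c : ℤ) (f : List ℤ) : unorm (uscale c f) ≤ c.natAbs * unorm f :=
  polyNorm_map (fun a => (Int.natAbs_mul c a).le) f

theorem bnorm_add (f g : List (List ℤ)) : bnorm (badd f g) ≤ bnorm f + bnorm g :=
  polyNorm_add unorm_add f g

theorem bnorm_mul (f g : List (List ℤ)) : bnorm (bmul f g) ≤ bnorm f * bnorm g :=
  polyNorm_mul unorm_add unorm_mul rfl f g

theorem bnorm_scale (c : ℤ) (f : List (List ℤ)) : bnorm (bscale c f) ≤ c.natAbs * bnorm f :=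
  polyNorm_map (unorm_scale c) f

theorem bwidth_add (f g : List (List ℤ)) : bwidth (badd f g) ≤ max (bwidth f) (bwidth g) :=
  polyMax_add (fun a b => (length_polyAdd a b).le) f g

theorem bwidth_mul (f g : List (List ℤ)) : bwidth (bmul f g) ≤ bwidth f + bwidth g :=
  polyMax_mul (fun a b => (length_polyAdd a b).le) length_polyMul_le rfl f g

theorem bwidth_scale (c : ℤ) (f : List (List ℤ)) : bwidth (bscale c f) ≤ bwidth f := by
  have := polyMax_map (ν := List.length) (c := 0) (m := uscale c) (fun a => by simp [uscale]) f
  simpa [bwidth, bscale] using this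

/-! ### Kronecker substitution

A polynomial with small coefficients is determined by its value at a large integer. -/

section Kronecker

variable {B : ℤ}

/-- The constant coefficient is divisible by B and smaller than B in absolute value, hence zero;
divide by the variable and repeat. -/
theorem X_pow_dvd_ueval_of_dvd {f : List ℤ} (h : (unorm f : ℤ) < B) {L : ℕ}
    (h' : B ^ L ∣ ueval B f) : (X : ℚ⟦X⟧) ^ L ∣ ueval X f := by
  induction f generalizing L with
  | nil => simp
  | cons c f ih =>
    have e : unorm (c :: f) = c.natAbs + unorm f := rfl
    cases L with
    | zero => simp
    | succ L =>
      simp only [ueval_cons, Int.cast_id] at h' ⊢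
      have h1 : B ∣ c := by
        have := (Dvd.intro_left (B ^ L) (pow_succ B L).symm).trans h'
        rwa [dvd_add_left (dvd_mul_right _ _)] at this
      have hc : c = 0 := Int.eq_zero_of_abs_lt_dvd h1 (by rw [Int.abs_eq_natAbs]; omega)
      have hB : B ≠ 0 := by omega
      subst hc
      rw [zero_add, pow_succ', mul_dvd_mul_iff_left hB] at h'
      rw [Int.cast_zero, zero_add, pow_succ']
      exact mul_dvd_mul_left X (ih (by omega) h')

theorem uzero_of_ueval_eq_zero {f : List ℤ} (h : (unorm f : ℤ) < B) (h' : ueval B f = 0) :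
    uzero f = true := by
  induction f with
  | nil => rfl
  | cons c f ih =>
    have e : unorm (c :: f) = c.natAbs + unorm f := rfl
    simp only [ueval_cons, Int.cast_id] at h'
    have hc : c = 0 := Int.eq_zero_of_abs_lt_dvd (m := B) ⟨-ueval B f, by linarith⟩
      (by rw [Int.abs_eq_natAbs]; omega)
    have hB : B ≠ 0 := by omega
    subst hc
    rw [zero_add, mul_eq_zero] at h'
    have := ih (by omega) (h'.resolve_left hB)
    simpa [uzero] using this

/-- The factor B on the left stands for an exponent `f.length - 1` on the right, which would
misbehave for the empty list. -/
theorem abs_ueval_mul_le (hB : 1 ≤ B) (f : List ℤ) :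
    |ueval B f| * B ≤ unorm f * B ^ f.length := by
  induction f with
  | nil => simp
  | cons c f ih =>
    have e : (unorm (c :: f) : ℤ) = |c| + unorm f := by
      rw [Int.abs_eq_natAbs]
      exact Int.natCast_add _ _
    have h1 : |c + B * ueval B f| ≤ |c| + B * |ueval B f| := by
      refine (abs_add_le _ _).trans ?_
      rw [abs_mul, abs_of_nonneg (show 0 ≤ B by omega)]
    have h2 : (1 : ℤ) ≤ B ^ f.length := one_le_pow₀ hB
    rw [e, ueval_cons, Int.cast_id, List.length_cons, pow_succ]
    have h3 : |c| * B ≤ |c| * B * B ^ f.length :=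
      le_mul_of_one_le_right (mul_nonneg (abs_nonneg c) (by omega)) h2
    have h4 := mul_le_mul_of_nonneg_right h1 (show 0 ≤ B by omega)
    have h5 := mul_le_mul_of_nonneg_left ih (show 0 ≤ B by omega)
    nlinarith

/-- With x = B^D every coefficient, evaluated at B, is smaller than B^D in absolute value, so the
blocks belonging to different powers of x cannot interact and vanish one by one. -/
theorem bzero_of_beval_eq_zero {D : ℕ} {f : List (List ℤ)} (h : (bnorm f : ℤ) < B)
    (hw : bwidth f ≤ D) (h' : beval B (B ^ D) f = 0) : bzero f = true := by
  induction f with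
  | nil => rfl
  | cons g f ih =>
    have e : bnorm (g :: f) = unorm g + bnorm f := rfl
    have ew : bwidth (g :: f) = max g.length (bwidth f) := rfl
    have hB : 1 ≤ B := by omega
    have h1 : |ueval B g| < B ^ D := by
      have h2 := abs_ueval_mul_le hB g
      have h3 : B ^ g.length ≤ B ^ D := pow_le_pow_right₀ hB (by omega)
      have h4 : (0 : ℤ) < B ^ D := by positivity
      have h5 : (unorm g : ℤ) < B := by omega
      by_contra! h6
      have h7 := mul_le_mul_of_nonneg_right h6 (show 0 ≤ B by omega)
      have h8 := mul_le_mul_of_nonneg_left h3 (show (0 : ℤ) ≤ unorm g by omega)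
      nlinarith
    rw [beval_cons] at h'
    have hg : ueval B g = 0 :=
      Int.eq_zero_of_abs_lt_dvd (m := B ^ D) ⟨-beval B (B ^ D) f, by linarith⟩ h1
    have hD : B ^ D ≠ 0 := by positivity
    rw [hg, zero_add, mul_eq_zero] at h'
    have h2 := ih (by omega) (by omega) (h'.resolve_left hD)
    simp only [bzero, List.all_cons, Bool.and_eq_true]
    exact ⟨uzero_of_ueval_eq_zero (by omega) hg, h2⟩

end Kronecker

/-! ### Arithmetic with packed polynomials -/

/-- Evaluation of a univariate integer polynomial at an integer. -/
def upack (b : ℤ) : List ℤ → ℤ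
  | [] => 0
  | c :: f => c + b * upack b f

/-- Evaluation of a bivariate integer polynomial at integers. -/
def bpack (b x : ℤ) : List (List ℤ) → ℤ
  | [] => 0
  | c :: f => upack b c + x * bpack b x f

theorem upack_eq (b : ℤ) (f : List ℤ) : upack b f = ueval b f := by
  induction f with
  | nil => rfl
  | cons c f ih => rw [upack, ih, ueval_cons, Int.cast_id]

theorem bpack_eq (b x : ℤ) (f : List (List ℤ)) : bpack b x f = beval b x f := by
  induction f with
  | nil => rfl
  | cons c f ih => rw [bpack, ih, upack_eq, beval_cons]

/-- Digits of an integer in base `M`, in the range from `-h` to `M - h`. -/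
def digits (M h : ℤ) : ℕ → ℤ → List ℤ
  | 0, _ => []
  | n + 1, z => bif z == 0 then [] else
    (fun r => r :: digits M h n (Int.ediv (z - r) M)) (Int.emod (z + h) M - h)

/-- The value substituted for `b` in bivariate polynomials. -/
def base : ℤ := Int.ofNat (Nat.pow 2 48)

/-- The value substituted for `x` in bivariate polynomials. -/
def wideBase : ℤ := Int.ofNat (Nat.pow 2 2304)

/-- The bivariate polynomial with small coefficients that has a given value. -/
def unpack (z : ℤ) : List (List ℤ) :=
  (digits wideBase (Int.ofNat (Nat.pow 2 2303)) 100 z).map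
    (digits base (Int.ofNat (Nat.pow 2 47)) 100)

/-- A bivariate polynomial, represented by its value at large integers and by bounds for its
coefficients and its degree. -/
structure Packed where
  value : ℤ
  norm : ℕ
  width : ℕ

namespace Packed

/-- The representation of a polynomial. -/
def of (f : List (List ℤ)) : Packed := ⟨bpack base wideBase f, bnorm f, bwidth f⟩

/-- Product. -/
def mul (p q : Packed) : Packed := ⟨p.value * q.value, p.norm * q.norm, p.width + q.width⟩

/-- Difference. -/
def sub (p q : Packed) : Packed := ⟨p.value - q.value, p.norm + q.norm, max p.width q.width⟩

/-- Zero. -/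
def zero : Packed := ⟨0, 0, 0⟩

/-- Product with `x`. -/
def shift (p : Packed) : Packed := ⟨wideBase * p.value, p.norm, p.width⟩

/-- Is the represented polynomial zero? -/
def isZero (p : Packed) : Bool := p.value == 0 && Nat.blt p.norm (Nat.pow 2 48) && Nat.ble p.width 48

/-- Does the polynomial represented by `p` divide the one represented by `q`? -/
def dvd (p q : Packed) : Bool := (q.sub (p.mul (of (unpack (Int.ediv q.value p.value))))).isZero

variable {R : Type*} [CommRing R] {b x : R}

/-- `p` represents a polynomial with value `y` at `b` and `x`. -/
def Represents (b x : R) (p : Packed) (y : R) : Prop :=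
  ∃ f, beval base wideBase f = p.value ∧ bnorm f ≤ p.norm ∧ bwidth f ≤ p.width ∧ beval b x f = y

theorem represents_of (f : List (List ℤ)) : Represents b x (of f) (beval b x f) :=
  ⟨f, (bpack_eq _ _ f).symm, le_rfl, le_rfl, rfl⟩

theorem represents_zero : Represents b x zero 0 := ⟨[], rfl, le_rfl, le_rfl, rfl⟩

/-- The product polynomial exists only in this proof; the computation merely multiplies two integers
and updates the bounds. -/
theorem Represents.mul {p q : Packed} {y z : R} (hp : Represents b x p y)
    (hq : Represents b x q z) : Represents b x (p.mul q) (y * z) := by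
  obtain ⟨f, hf1, hf2, hf3, hf4⟩ := hp
  obtain ⟨g, hg1, hg2, hg3, hg4⟩ := hq
  refine ⟨bmul f g, ?_, (bnorm_mul f g).trans (Nat.mul_le_mul hf2 hg2),
    (bwidth_mul f g).trans (Nat.add_le_add hf3 hg3), ?_⟩
  · rw [beval_mul, hf1, hg1, Packed.mul]
  · rw [beval_mul, hf4, hg4]

theorem Represents.sub {p q : Packed} {y z : R} (hp : Represents b x p y)
    (hq : Represents b x q z) : Represents b x (p.sub q) (y - z) := by
  obtain ⟨f, hf1, hf2, hf3, hf4⟩ := hp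
  obtain ⟨g, hg1, hg2, hg3, hg4⟩ := hq
  refine ⟨badd f (bscale (-1) g), ?_, ?_, ?_, ?_⟩
  · rw [beval_add, beval_scale, hf1, hg1, Packed.sub, Int.cast_id]
    ring
  · have h1 := bnorm_add f (bscale (-1) g)
    have h2 := bnorm_scale (-1) g
    rw [Int.natAbs_neg, Int.natAbs_one, one_mul] at h2
    simp only [Packed.sub]
    omega
  · have h1 := bwidth_add f (bscale (-1) g)
    have h2 := bwidth_scale (-1) g
    simp only [Packed.sub]
    omega
  · rw [beval_add, beval_scale, hf4, hg4]
    push_cast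
    ring

theorem Represents.shift {p : Packed} {y : R} (hp : Represents b x p y) :
    Represents b x p.shift (x * y) := by
  obtain ⟨f, hf1, hf2, hf3, hf4⟩ := hp
  refine ⟨[] :: f, ?_, ?_, ?_, ?_⟩
  · simp [Packed.shift, hf1]
  · have : bnorm ([] :: f) = 0 + bnorm f := rfl
    simpa [Packed.shift, this] using hf2
  · have : bwidth ([] :: f) = max 0 (bwidth f) := rfl
    simpa [Packed.shift, this] using hf3
  · simp [hf4]

/-- By the recorded bounds, a zero value forces the represented polynomial itself to vanish, and
hence its value at any point of any commutative ring. -/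
theorem Represents.eq_zero {p : Packed} {y : R} (hp : Represents b x p y)
    (h : p.isZero = true) : y = 0 := by
  obtain ⟨f, hf1, hf2, hf3, rfl⟩ := hp
  simp only [isZero, Bool.and_eq_true, beq_iff_eq, Nat.blt_eq, Nat.ble_eq] at h
  have hb : base = 2 ^ 48 := by decide +kernel
  -- 2304 = 48 · 48, which leaves room for degrees below 48 in b.
  have hx : wideBase = base ^ 48 := by decide +kernel
  have hn : Nat.pow 2 48 = 2 ^ 48 := rfl
  rw [hx, h.1.1] at hf1
  refine beval_eq_zero b x (bzero_of_beval_eq_zero (B := base) (D := 48) ?_ (by omega) hf1)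
  rw [hb]
  have := h.1.2
  rw [hn] at this
  zify at this
  push_cast at this
  have : (bnorm f : ℤ) ≤ p.norm := by exact_mod_cast hf2
  linarith

/-- The candidate quotient comes from integer division and digit extraction. Nothing is proved about
these: the difference of q and p times the quotient is tested to be the zero polynomial, so a wrong
guess only makes the test fail. -/
theorem Represents.eq_zero_of_dvd {p q : Packed} {z : R} (hp : Represents b x p 0)
    (hq : Represents b x q z) (h : dvd p q = true) : z = 0 := by
  have := (hq.sub (hp.mul (represents_of _))).eq_zero h
  rwa [zero_mul, sub_zero] at this

end Packed

end PatternAvoidance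

namespace PatternAvoidance

open PowerSeries (X C coeff constantCoeff)

/-! ### The system of equations of a pattern -/

/-- Boolean version of `RootedSubtree`. -/
def subtreeB : BinaryTree Unit → BinaryTree Unit → Bool
  | .nil, _ => true
  | .node _ _ _, .nil => false
  | .node _ l r, .node _ l' r' => subtreeB l l' && subtreeB r r'

theorem subtreeB_iff (s t : BinaryTree Unit) : subtreeB s t = true ↔ RootedSubtree s t := by
  induction s generalizing t with
  | nil => simp [subtreeB, rootedSubtree_nil]
  | node a l r hl hr => cases t <;> simp [subtreeB, RootedSubtree, hl, hr]

/-- Boolean equality of trees. -/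
def eqB : BinaryTree Unit → BinaryTree Unit → Bool
  | .nil, .nil => true
  | .nil, .node _ _ _ => false
  | .node _ _ _, .nil => false
  | .node _ l r, .node _ l' r' => eqB l l' && eqB r r'

theorem eqB_iff (s t : BinaryTree Unit) : eqB s t = true ↔ s = t := by
  induction s generalizing t with
  | nil => cases t <;> simp [eqB]
  | node a l r hl hr => cases t <;> simp [eqB, hl, hr]

/-- The trees to which the fundamental recursion for `p` refers. -/
def children (t p : BinaryTree Unit) : List (BinaryTree Unit) :=
  [p.left, p.right, (union p t).left, (union p t).right]

/-- The trees reachable from a list by the fundamental recursion, in order of their discovery. -/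
def reachable (t : BinaryTree Unit) :
    ℕ → List (BinaryTree Unit) → List (BinaryTree Unit) → List (BinaryTree Unit)
  | 0, _, seen => seen
  | _ + 1, [], seen => seen
  | n + 1, p :: todo, seen =>
    bif subtreeB t p || seen.any (eqB p) then reachable t n todo seen
    else reachable t n (children t p ++ todo) (seen ++ [p])

/-- The trees that occur in the recursion for the series of all `t`-avoiding trees. -/
def states (t : BinaryTree Unit) : List (BinaryTree Unit) := reachable t 1000 [.nil] []

/-- The label of a tree in a table of labels; label `0` is reserved for the trees containing `t` as
a rooted subtree. -/
def label (t : BinaryTree Unit) (S : List (BinaryTree Unit × ℕ)) (p : BinaryTree Unit) : Option ℕ :=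
  bif subtreeB t p then some 0 else (S.find? fun s => eqB p s.1).map Prod.snd

/-- An instance of the fundamental recursion in terms of labels. -/
structure Equation where
  /-- is it the recursion for the one-leaf tree? -/
  isNil : Bool
  lhs : ℕ
  left : ℕ
  right : ℕ
  left' : ℕ
  right' : ℕ

/-- The equation holds modulo `X ^ L`. -/
def Equation.Holds (L : ℕ) (ser : ℕ → ℚ⟦X⟧) (e : Equation) : Prop :=
  X ^ L ∣ ser e.lhs - ((bif e.isNil then X else 0) + ser e.left * ser e.right
    - ser e.left' * ser e.right')

/-- The instance of the recursion for a labelled tree. -/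
def equation (t : BinaryTree Unit) (S : List (BinaryTree Unit × ℕ)) (s : BinaryTree Unit × ℕ) :
    Option Equation :=
  match (children t s.1).map (label t S) with
  | [some j, some k, some l, some m] => some ⟨eqB s.1 .nil, s.2, j, k, l, m⟩
  | _ => none

/-- The instances of the recursion, with labels in `S`, for a list of labelled trees. -/
def equations (t : BinaryTree Unit) (S : List (BinaryTree Unit × ℕ)) :
    List (BinaryTree Unit × ℕ) → Option (List Equation)
  | [] => some []
  | s :: S' =>
    match equation t S s, equations t S S' with
    | some e, some E => some (e :: E)
    | _, _ => none

/-- The complete system of equations for a pattern with given labels of the states, provided that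
the one-leaf tree has label `1`. -/
def system (t : BinaryTree Unit) (ids : List ℕ) : Option (List Equation) :=
  (fun S => match label t S .nil with
    | some 1 => equations t S S
    | _ => none) ((states t).zip ids)

theorem exists_equation {t : BinaryTree Unit} {S S' : List (BinaryTree Unit × ℕ)}
    {E : List Equation} (h : equations t S S' = some E) {s : BinaryTree Unit × ℕ} (hs : s ∈ S') :
    ∃ e ∈ E, equation t S s = some e := by
  induction S' generalizing E with
  | nil => simp at hs
  | cons s' S' ih =>
    rw [equations] at h
    split at h
    · rename_i e E' h1 h2
      obtain rfl : e :: E' = E := by simpa using h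
      rcases List.mem_cons.1 hs with rfl | hs
      · exact ⟨e, by simp, h1⟩
      · obtain ⟨e', he', h3⟩ := ih h2 hs
        exact ⟨e', by simp [he'], h3⟩
    · simp at h

theorem label_eq_some {t p : BinaryTree Unit} {S : List (BinaryTree Unit × ℕ)} {i : ℕ}
    (h : label t S p = some i) : (RootedSubtree t p ∧ i = 0) ∨ (p, i) ∈ S := by
  rw [label] at h
  cases hp : subtreeB t p with
  | true =>
    rw [hp, cond_true, Option.some.injEq] at h
    exact Or.inl ⟨(subtreeB_iff t p).1 hp, h.symm⟩
  | false =>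
    rw [hp, cond_false, Option.map_eq_some_iff] at h
    obtain ⟨s, hs, rfl⟩ := h
    have h1 := List.find?_some hs
    rw [eqB_iff] at h1
    exact Or.inr (h1 ▸ List.mem_of_find?_eq_some hs)

/-- Solutions of the system of equations of a pattern are series of avoiders. -/
theorem dvd_sub_of_system {t : BinaryTree Unit} {ids : List ℕ} {E : List Equation}
    (h : system t ids = some E) {L : ℕ} {ser : ℕ → ℚ⟦X⟧} (h0 : ser 0 = 0) (hX : ∀ i, X ∣ ser i)
    (hE : ∀ e ∈ E, e.Holds L ser) : X ^ L ∣ ser 1 - avoiderSeries t .nil := by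
  rw [system] at h
  set S := (states t).zip ids
  have hnil : label t S .nil = some 1 ∧ equations t S S = some E := by
    beta_reduce at h
    split at h
    · rename_i h1
      exact ⟨h1, h⟩
    · simp at h
  -- For t = nil every tree, including `nil`, would have label 0 and not 1.
  have ht : t ≠ .nil := by
    rintro rfl
    simp [label, subtreeB] at hnil
  let W : BinaryTree Unit → ℚ⟦X⟧ := fun p => ser ((label t S p).getD 0)
  have hW : ∀ {p i}, label t S p = some i → W p = ser i := fun {p i} hp => by simp [W, hp]
  -- The labelled trees are closed under the recursion because `equation` fails when a child has no
  -- label. Thus neither completeness of `reachable` nor its fuel matters, and different trees may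
  -- share a label.
  have key := dvd_sub_avoiderSeries ht {p | ∃ i, label t S p = some i} W L ?_ .nil ⟨1, hnil.1⟩
  · rwa [hW hnil.1] at key
  · rintro p ⟨i, hp⟩
    rw [hW hp]
    rcases label_eq_some hp with ⟨h1, rfl⟩ | h1
    · exact Or.inl ⟨h1, h0⟩
    · obtain ⟨e, he, h2⟩ := exists_equation hnil.2 h1
      have h3 := hE e he
      rw [equation] at h2
      split at h2
      · rename_i j k l m h4
        simp only [children, List.map_cons, List.map_nil, List.cons.injEq, and_true] at h4
        obtain ⟨hj, hk, hl, hm⟩ := h4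
        obtain rfl := Option.some.inj h2
        refine Or.inr ⟨⟨j, hj⟩, ⟨k, hk⟩, ⟨l, hl⟩, ⟨m, hm⟩, hX i, ?_⟩
        rw [hW hj, hW hk, hW hl, hW hm]
        simp only [Equation.Holds] at h3
        convert h3 using 4
        by_cases hpn : p = .nil
        · simp [hpn, eqB]
        · have : eqB p .nil = false := by rw [← Bool.not_eq_true, eqB_iff]; exact hpn
          simp [hpn, this]
      · simp at h2

/-! ### Certificates for Wilf equivalences -/

/-- Boolean equality of equations. -/
def Equation.beq (e f : Equation) : Bool :=
  (e.isNil == f.isNil) && Nat.beq e.lhs f.lhs && Nat.beq e.left f.left &&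
    Nat.beq e.right f.right && Nat.beq e.left' f.left' && Nat.beq e.right' f.right'

theorem Equation.eq_of_beq {e f : Equation} (h : e.beq f = true) : e = f := by
  cases e
  cases f
  simp only [Equation.beq, Bool.and_eq_true, beq_iff_eq, Nat.beq_eq] at h
  simp [h]

/-- Add the elements of a list to another list without repetitions. -/
def insertNew : List Equation → List Equation → List Equation
  | [], F => F
  | e :: E, F => insertNew E (bif F.any e.beq then F else e :: F)

theorem mem_insertNew {e : Equation} {E F : List Equation} (h : e ∈ E ∨ e ∈ F) :
    e ∈ insertNew E F := by
  induction E generalizing F with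
  | nil => simpa [insertNew] using h
  | cons e' E ih =>
    refine ih ?_
    rw [List.mem_cons] at h
    rcases h with (rfl | h) | h
    · right
      cases h : F.any e.beq with
      | true =>
        obtain ⟨f, hf, h'⟩ := List.any_eq_true.1 h
        exact Equation.eq_of_beq h' ▸ hf
      | false => simp
    · exact Or.inl h
    · right
      cases F.any e'.beq <;> simp [h]

/-- The union of the systems of equations of several patterns, which are given by their positions in
the list `T` and the labels of their states. -/
def collect (T : List (BinaryTree Unit)) :
    List (ℕ × List ℕ) → List Equation → Option (List Equation)
  | [], F => some F
  | m :: M, F =>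
    match system (T.getD m.1 .nil) m.2 with
    | some E => collect T M (insertNew E F)
    | none => none

theorem exists_system_of_collect {T : List (BinaryTree Unit)} {M : List (ℕ × List ℕ)}
    {E F : List Equation} (h : collect T M F = some E) :
    F ⊆ E ∧ ∀ m ∈ M, ∃ E' ⊆ E, system (T.getD m.1 .nil) m.2 = some E' := by
  induction M generalizing F with
  | nil =>
    obtain rfl : F = E := by simpa [collect] using h
    simp
  | cons m M ih =>
    rw [collect] at h
    split at h
    · rename_i E' h1
      obtain ⟨h2, h3⟩ := ih h
      refine ⟨fun e he => h2 (mem_insertNew (Or.inr he)), fun m' hm' => ?_⟩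
      rcases List.mem_cons.1 hm' with rfl | hm'
      · exact ⟨E', fun e he => h2 (mem_insertNew (Or.inl he)), h1⟩
      · exact h3 m' hm'
    · simp at h

/-- A certificate for the Wilf equivalence of a set of patterns. -/
structure Certificate where
  /-- polynomial `F` in `b` and `x`, which defines a power series `b` -/
  F : List (List ℤ)
  /-- order of the partial derivative of `F` with respect to `b` -/
  k : ℕ
  /-- initial coefficients of `b` -/
  b : List ℤ
  /-- numerators and denominators of rational functions in `b` and `x` -/
  R : List (List (List ℤ) × List (List ℤ))
  /-- patterns, as positions in a list, with the labels of their states -/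
  members : List (ℕ × List ℕ)

namespace Certificate

variable (c : Certificate)

/-- The rational function with a given label. -/
def fn (i : ℕ) : List (List ℤ) × List (List ℤ) := (([], [[1]]) :: c.R).getD i ([], [[1]])

/-- The numerator of the rational function with a given label. -/
def num (i : ℕ) : Packed := Packed.of (c.fn i).1

/-- The denominator of the rational function with a given label. -/
def den (i : ℕ) : Packed := Packed.of (c.fn i).2

/-- The polynomial obtained from an equation by clearing denominators. -/
def clear (e : Equation) : Packed :=
  (fun d d' =>
    ((c.num e.lhs).mul (d.mul d')).sub ((c.den e.lhs).mul
      ((((c.num e.left).mul (c.num e.right)).mul d').sub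
        ((((c.num e.left').mul (c.num e.right')).mul d).sub
          (bif e.isNil then (d.mul d').shift else Packed.zero)))))
    ((c.den e.left).mul (c.den e.right)) ((c.den e.left').mul (c.den e.right'))

/-- Order of a truncated series (its length if it vanishes). -/
def order : List ℤ → ℕ
  | [] => 0
  | c :: f => bif c == 0 then order f + 1 else 0

/-- The rational function defines a power series without constant term. -/
def fnOK (r : List (List ℤ) × List (List ℤ)) : Bool :=
  (fun d => Nat.blt (order d) c.b.length && hasOrder (order d) d &&
    lowZero (order d + 1) (btrunc c.b.length c.b r.1)) (btrunc c.b.length c.b r.2)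

/-- The certificate defines a power series `b`, and its rational functions define power series
without constant term. -/
def rootOK : Bool :=
  Nat.blt c.k c.b.length && lowZero (c.b.length + c.k) (btrunc (c.b.length + c.k) c.b c.F) &&
    hasOrder c.k (btrunc (c.b.length + c.k) c.b (bderiv c.F)) && c.R.all c.fnOK

/-- The rational functions solve the equations of all patterns. -/
def systemOK (T : List (BinaryTree Unit)) : Bool :=
  match collect T c.members [] with
  | some E => (fun F => E.all fun e => F.dvd (c.clear e)) (Packed.of c.F)
  | none => false

variable {c}

theorem exists_beval_eq_zero (h : c.rootOK = true) :
    ∃ β : ℚ⟦X⟧, X ^ c.b.length ∣ β - ueval X c.b ∧ beval β X c.F = 0 := by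
  simp only [rootOK, Bool.and_eq_true, Nat.blt_eq] at h
  obtain ⟨⟨⟨h1, h2⟩, h3⟩, -⟩ := h
  -- As the starting point of Hensel's lemma the stored list is an exact polynomial, so it may be
  -- used beyond its own length.
  have hb : (X : ℚ⟦X⟧) ^ (c.b.length + c.k) ∣ ueval X c.b - ueval X c.b := by simp
  obtain ⟨w, hw, h4⟩ := exists_eq_X_pow_mul_of_hasOrder h3 (by omega)
    (X_pow_dvd_beval_sub_btrunc hb (bderiv c.F))
  refine exists_root c.F _ w h1 ?_ hw h4
  have h5 := X_pow_dvd_beval_sub_btrunc hb c.F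
  have := dvd_add h5 (X_pow_dvd_ueval_of_lowZero h2)
  rwa [sub_add_cancel] at this

/-- The denominator is X^e times a unit and the numerator is divisible by X^(e + 1). Both can be
read off from the known coefficients of β, since e is smaller than their number. -/
theorem exists_quotient {β : ℚ⟦X⟧} (hβ : X ^ c.b.length ∣ β - ueval X c.b)
    {r : List (List ℤ) × List (List ℤ)} (h : c.fnOK r = true) :
    beval β X r.2 ≠ 0 ∧ ∃ W : ℚ⟦X⟧, X ∣ W ∧ beval β X r.2 * W = beval β X r.1 := by
  simp only [fnOK, Bool.and_eq_true, Nat.blt_eq] at h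
  obtain ⟨⟨h1, h2⟩, h3⟩ := h
  set e := order (btrunc c.b.length c.b r.2)
  obtain ⟨w, hw, h4⟩ := exists_eq_X_pow_mul_of_hasOrder h2 h1 (X_pow_dvd_beval_sub_btrunc hβ r.2)
  have h5 : X ^ (e + 1) ∣ beval β X r.1 := by
    have h6 := (pow_dvd_pow (X : ℚ⟦X⟧) (show e + 1 ≤ c.b.length by omega)).trans
      (X_pow_dvd_beval_sub_btrunc hβ r.1)
    have := dvd_add h6 (X_pow_dvd_ueval_of_lowZero h3)
    rwa [sub_add_cancel] at this
  obtain ⟨n, hn⟩ := h5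
  refine ⟨?_, X * n * w⁻¹, ⟨n * w⁻¹, by ring⟩, ?_⟩
  · rw [h4]
    refine mul_ne_zero (pow_ne_zero _ PowerSeries.X_ne_zero) ?_
    rintro rfl
    simp at hw
  · rw [h4, hn]
    linear_combination X ^ (e + 1) * n * PowerSeries.mul_inv_cancel w hw

/-- A valid certificate proves Wilf equivalence of its members. -/
theorem exists_avoiderSeries_eq {T : List (BinaryTree Unit)} (h : c.rootOK = true)
    (h' : c.systemOK T = true) :
    ∃ a, ∀ m ∈ c.members, avoiderSeries (T.getD m.1 .nil) .nil = a := by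
  obtain ⟨β, hβ, hF⟩ := exists_beval_eq_zero h
  have hfn : ∀ i, beval β X (c.fn i).2 ≠ 0 ∧
      ∃ W : ℚ⟦X⟧, X ∣ W ∧ beval β X (c.fn i).2 * W = beval β X (c.fn i).1 := by
    have hall : ∀ r ∈ c.R, c.fnOK r = true := by
      simp only [rootOK, Bool.and_eq_true] at h
      exact List.all_eq_true.1 h.2
    intro i
    -- Label 0 and labels beyond the list both stand for the fraction 0 / 1.
    have h0 : beval β X [[1]] ≠ (0 : ℚ⟦X⟧) ∧
        ∃ W : ℚ⟦X⟧, X ∣ W ∧ beval β X [[1]] * W = beval β X [] :=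
      ⟨by simp, 0, by simp, by simp⟩
    rw [fn]
    cases i with
    | zero => exact h0
    | succ i =>
      rw [List.getD_cons_succ]
      rcases lt_or_ge i c.R.length with hi | hi
      · rw [List.getD_eq_getElem _ _ hi]
        exact exists_quotient hβ (hall _ (List.getElem_mem hi))
      · rw [List.getD_eq_default _ _ hi]
        exact h0
  choose hd ser hX hser using hfn
  have h0 : ser 0 = 0 := by
    have := hser 0
    simpa [fn] using this
  rw [systemOK] at h'
  split at h'
  · rename_i E hE
    obtain ⟨-, hsys⟩ := exists_system_of_collect hE
    have hR : Packed.Represents β X (Packed.of c.F) 0 := hF ▸ Packed.represents_of c.F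
    have hold : ∀ e ∈ E, ∀ L, e.Holds L ser := by
      intro e he L
      have hn : ∀ i, (c.num i).Represents β X (beval β X (c.fn i).2 * ser i) := fun i =>
        (hser i).symm ▸ Packed.represents_of _
      have hd' : ∀ i, (c.den i).Represents β X (beval β X (c.fn i).2) := fun i =>
        Packed.represents_of _
      have hs : Packed.Represents β X (bif e.isNil then (((c.den e.left).mul (c.den e.right)).mul
            ((c.den e.left').mul (c.den e.right'))).shift else Packed.zero)
          ((bif e.isNil then X else 0) * (beval β X (c.fn e.left).2 * beval β X (c.fn e.right).2 *
            (beval β X (c.fn e.left').2 * beval β X (c.fn e.right').2))) := by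
        cases e.isNil with
        | true => exact (((hd' _).mul (hd' _)).mul ((hd' _).mul (hd' _))).shift
        | false =>
          rw [cond_false, cond_false, zero_mul]
          exact Packed.represents_zero
      -- The cleared equation is a multiple of F, and F vanishes at β. The product of the
      -- denominators is nonzero and can be cancelled afterwards.
      have key := Packed.Represents.eq_zero_of_dvd hR
        (((hn e.lhs).mul (((hd' e.left).mul (hd' e.right)).mul
          ((hd' e.left').mul (hd' e.right')))).sub ((hd' e.lhs).mul
            ((((hn e.left).mul (hn e.right)).mul ((hd' e.left').mul (hd' e.right'))).sub
              ((((hn e.left').mul (hn e.right')).mul ((hd' e.left).mul (hd' e.right))).sub hs))))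
        (List.all_eq_true.1 h' e he)
      have : ser e.lhs - ((bif e.isNil then X else 0) + ser e.left * ser e.right
          - ser e.left' * ser e.right') = 0 := by
        have hne := mul_ne_zero (hd e.lhs) (mul_ne_zero (mul_ne_zero (hd e.left) (hd e.right))
          (mul_ne_zero (hd e.left') (hd e.right')))
        refine (mul_eq_zero.1 (Eq.trans ?_ key)).resolve_left hne
        ring
      rw [Equation.Holds, this]
      exact dvd_zero _
    -- In the system of every member the one-leaf tree carries label 1, so this series is common to
    -- all members.
    refine ⟨ser 1, fun m hm => ?_⟩
    obtain ⟨E', hE', hm'⟩ := hsys m hm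
    refine (sub_eq_zero.1 (eq_zero_of_forall_X_pow_dvd fun L => ?_)).symm
    exact dvd_sub_of_system hm' h0 hX fun e he => hold e (hE' he) L
  · simp at h'

end Certificate

end PatternAvoidance

namespace PatternAvoidance

open PowerSeries (X C coeff constantCoeff)

/-! ### Initial coefficients of the series of avoiders -/

/-- The easy direction of Kronecker substitution, needing no bound on the coefficients: it makes the
residue used in `code` depend on the series only. -/
theorem pow_dvd_ueval_of_X_pow_dvd {f : List ℤ} {L : ℕ} (h : (X : ℚ⟦X⟧) ^ L ∣ ueval X f) (B : ℤ) :
    B ^ L ∣ ueval B f := by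
  induction f generalizing L with
  | nil => simp
  | cons c f ih =>
    cases L with
    | zero => simp
    | succ L =>
      rw [ueval_cons] at h ⊢
      have hc : c = 0 := by
        have h1 := (Dvd.intro_left _ (pow_succ (X : ℚ⟦X⟧) L).symm).trans h
        rw [PowerSeries.X_dvd_iff] at h1
        simpa using h1
      subst hc
      rw [Int.cast_zero, zero_add, pow_succ', mul_dvd_mul_iff_left PowerSeries.X_ne_zero] at h
      rw [Int.cast_zero, zero_add, pow_succ']
      exact mul_dvd_mul_left B (ih h)

/-- The value substituted for `x` in univariate polynomials. -/
def numBase : ℤ := Int.ofNat (Nat.pow 2 96)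

/-- The number of coefficients that are computed. -/
def precision : ℕ := 26

/-- The value of the power of the variable modulo which we compute. -/
def modulus : ℤ := Int.ofNat (Nat.pow 2 2496)

theorem modulus_eq : modulus = numBase ^ precision := by decide +kernel

/-- Right hand side of an equation, at integers. -/
def Equation.rhs (e : Equation) (val : ℕ → ℤ) : ℤ :=
  (bif e.isNil then numBase else 0) + val e.left * val e.right - val e.left' * val e.right'

/-- Iterative solution of a system of equations in which the left hand side of the `i`-th equation
has label `i + 1`. -/
def solve (E : List Equation) : ℕ → List ℤ
  | 0 => []
  | n + 1 => (fun V => E.map fun e => Int.emod (e.rhs fun i => (0 :: V).getD i 0) modulus) (solve E n)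

/-- Do the polynomials `U`, of labels `1, 2, …`, solve the equations to the given precision? -/
def solves (E : List Equation) (U : List (List ℤ)) : Bool :=
  (U.all fun f => lowZero 1 f && Nat.ble (unorm f) (Nat.pow 2 44)) &&
    (fun V => E.all fun e => Int.emod ((0 :: V).getD e.lhs 0 - e.rhs fun i => (0 :: V).getD i 0) modulus
      == 0) (U.map (upack numBase))

/-- The first coefficients of the series of `t`-avoiders, encoded as an integer. -/
def code (t : BinaryTree Unit) : Option ℤ :=
  match system t (List.range' 1 (states t).length) with
  | some E =>
    (fun U => bif solves E U then some (Int.emod (upack numBase (U.getD 0 [])) modulus) else none)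
      ((solve E precision).map (digits numBase 0 precision))
  | none => none

/-- The difference P of the two sides has norm at most 2^44 + 1 + 2 · 2^88 < 2^96, so divisibility
of its value at 2^96 by 2^(96 · 26) lifts to divisibility by X^26. How U was found plays no role. -/
theorem Equation.holds_of_solves {E : List Equation} {U : List (List ℤ)} (h : solves E U = true)
    {e : Equation} (he : e ∈ E) : e.Holds precision fun i => ueval X (([] :: U).getD i []) := by
  simp only [solves, Bool.and_eq_true, List.all_eq_true, beq_iff_eq, Nat.ble_eq] at h
  obtain ⟨h1, h2⟩ := h
  have hU : ∀ i, unorm (([] :: U).getD i []) ≤ 2 ^ 44 := by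
    intro i
    rcases lt_or_ge i ([] :: U).length with hi | hi
    · rw [List.getD_eq_getElem _ _ hi]
      rcases List.mem_cons.1 (List.getElem_mem hi) with h | h
      · rw [h]
        exact Nat.zero_le _
      · exact (h1 _ h).2
    · rw [List.getD_eq_default _ _ hi]
      exact Nat.zero_le _
  have hV : ∀ i, (0 :: U.map (upack numBase)).getD i 0 = ueval numBase (([] :: U).getD i []) := by
    intro i
    rw [← upack_eq]
    exact List.getD_map (f := upack numBase) (l := [] :: U) (d := []) (n := i)
  have h3 : numBase ^ precision ∣ ueval numBase (([] :: U).getD e.lhs []) -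
      ((bif e.isNil then numBase else 0) + ueval numBase (([] :: U).getD e.left [])
        * ueval numBase (([] :: U).getD e.right []) - ueval numBase (([] :: U).getD e.left' [])
        * ueval numBase (([] :: U).getD e.right' [])) := by
    rw [← modulus_eq]
    have := Int.dvd_of_emod_eq_zero (h2 e he)
    simpa only [Equation.rhs, hV] using this
  set fi := ([] :: U).getD e.lhs []
  set fj := ([] :: U).getD e.left []
  set fk := ([] :: U).getD e.right []
  set fl := ([] :: U).getD e.left' []
  set fm := ([] :: U).getD e.right' []
  set x : List ℤ := bif e.isNil then [0, 1] else [] with hx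
  have hxe : ∀ {R : Type} [CommRing R] (b : R), ueval b x = bif e.isNil then b else 0 := by
    intro R _ b
    rw [hx]
    cases e.isNil <;> simp
  let P := uadd fi (uscale (-1) (uadd (uadd x (umul fj fk)) (uscale (-1) (umul fl fm))))
  have hP : ∀ {R : Type} [CommRing R] (b : R), ueval b P = ueval b fi -
      ((bif e.isNil then b else 0) + ueval b fj * ueval b fk - ueval b fl * ueval b fm) := by
    intro R _ b
    simp only [P, ueval_add, ueval_scale, ueval_mul, hxe]
    push_cast
    ring
  have hn : (unorm P : ℤ) < numBase := by
    have a1 := unorm_add fi (uscale (-1) (uadd (uadd x (umul fj fk)) (uscale (-1) (umul fl fm))))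
    have a2 := unorm_scale (-1) (uadd (uadd x (umul fj fk)) (uscale (-1) (umul fl fm)))
    have a3 := unorm_add (uadd x (umul fj fk)) (uscale (-1) (umul fl fm))
    have a4 := unorm_add x (umul fj fk)
    have a5 := unorm_scale (-1) (umul fl fm)
    have a6 := (unorm_mul fj fk).trans (Nat.mul_le_mul (hU e.left) (hU e.right))
    have a7 := (unorm_mul fl fm).trans (Nat.mul_le_mul (hU e.left') (hU e.right'))
    have a8 : unorm x ≤ 1 := by
      rw [hx]
      cases e.isNil <;> decide
    have a9 : unorm fi ≤ 17592186044416 := hU e.lhs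
    rw [Int.natAbs_neg, Int.natAbs_one, one_mul] at a2 a5
    have hB : numBase = 2 ^ 96 := by decide +kernel
    rw [hB]
    norm_num at a6 a7
    change unorm P ≤ _ at a1
    norm_num
    omega
  have := X_pow_dvd_ueval_of_dvd (L := precision) hn (by rw [hP]; exact h3)
  rwa [hP] at this

theorem dvd_sub_of_code {t : BinaryTree Unit} {v : ℤ} (h : code t = some v) :
    ∃ f : List ℤ, X ^ precision ∣ ueval X f - avoiderSeries t .nil ∧
      Int.emod (ueval numBase f) modulus = v := by
  rw [code] at h
  split at h
  · rename_i E hE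
    beta_reduce at h
    set U := (solve E precision).map (digits numBase 0 precision)
    cases hU : solves E U with
    | false => simp [hU] at h
    | true =>
      rw [hU, cond_true, Option.some.injEq, upack_eq] at h
      refine ⟨U.getD 0 [], ?_, h⟩
      refine dvd_sub_of_system hE (ser := fun i => ueval X (([] :: U).getD i [])) rfl ?_
        fun e he => Equation.holds_of_solves hU he
      intro i
      rcases lt_or_ge i ([] :: U).length with hi | hi
      · rw [List.getD_eq_getElem _ _ hi]
        rcases List.mem_cons.1 (List.getElem_mem hi) with h | h
        · rw [h]
          exact dvd_zero _
        · simp only [solves, Bool.and_eq_true, List.all_eq_true] at hU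
          simpa using X_pow_dvd_ueval_of_lowZero (hU.1 _ h).1
      · rw [List.getD_eq_default _ _ hi]
        exact dvd_zero _
  · simp at h

/-- Wilf equivalent patterns have the same code. -/
theorem code_eq_of_avoiderSeries_eq {s t : BinaryTree Unit} {v w : ℤ} (hs : code s = some v)
    (ht : code t = some w) (h : avoiderSeries s .nil = avoiderSeries t .nil) : v = w := by
  obtain ⟨f, hf, rfl⟩ := dvd_sub_of_code hs
  obtain ⟨g, hg, rfl⟩ := dvd_sub_of_code ht
  have h1 : (X : ℚ⟦X⟧) ^ precision ∣ ueval X (uadd f (uscale (-1) g)) := by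
    rw [ueval_add, ueval_scale]
    have := dvd_sub hf hg
    rw [h, sub_sub_sub_cancel_right] at this
    convert this using 1
    push_cast
    ring
  have h2 := pow_dvd_ueval_of_X_pow_dvd h1 numBase
  rw [ueval_add, ueval_scale, ← modulus_eq] at h2
  refine Int.ModEq.symm (Int.modEq_iff_dvd.2 ?_)
  convert h2 using 1
  push_cast
  ring

end PatternAvoidance

namespace PatternAvoidance

/-! ### The patterns with eight leaves -/

/-- The trees with `n` internal vertices, provided that `n < f`. -/
def treesOf : ℕ → ℕ → List (BinaryTree Unit)
  | 0, _ => []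
  | _ + 1, 0 => [.nil]
  | f + 1, n + 1 => (List.range (n + 1)).flatMap fun i =>
    (treesOf f i).flatMap fun l => (treesOf f (n - i)).map fun r => .node () l r

theorem mem_treesOf (f : ℕ) (T : BinaryTree Unit) (h : T.numNodes < f) :
    T ∈ treesOf f T.numNodes := by
  induction T generalizing f with
  | nil =>
    cases f with
    | zero => simp at h
    | succ f => simp [treesOf]
  | node a l r hl hr =>
    cases f with
    | zero => simp at h
    | succ f =>
      simp only [BinaryTree.numNodes] at h ⊢
      rw [treesOf]
      simp only [List.mem_flatMap, List.mem_range, List.mem_map]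
      refine ⟨l.numNodes, by omega, l, hl f (by omega), r, ?_, rfl⟩
      rw [show l.numNodes + r.numNodes - l.numNodes = r.numNodes by omega]
      exact hr f (by omega)

/-- The list of all patterns with eight leaves. -/
def patterns : List (BinaryTree Unit) := treesOf 8 7

theorem mem_patterns {T : BinaryTree Unit} (h : T.numLeaves = 8) : T ∈ patterns := by
  have h1 := BinaryTree.numLeaves_eq_numNodes_succ T
  have h2 : T.numNodes = 7 := by omega
  rw [patterns, ← h2]
  exact mem_treesOf 8 T (by omega)

/-- The pattern at a given position of the list. -/
def pattern (i : ℕ) : BinaryTree Unit := patterns.getD i .nil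

/-- Certificates for the Wilf classes that do not just consist of a pattern and its mirror image. -/
def certificates : List Certificate := [
  -- Outer lists run over powers of x, inner ones over powers of b, so [[0,1]] is b. Label 1 is b:
  -- the root is the avoider series itself and starts with Catalan numbers, as all trees with fewer
  -- than eight leaves avoid the pattern.
  { F := [[0,1], [-1,-2,-1,-1,-1,-1], [1,1,1,1,1]]
    k := 0
    b := [0,1,1,2,5,14]
    R := [([[0,1]], [[1]]), ([[0,-1,1],[1]], [[0,1]]), ([[0,1],[-1]], [[1]]),
      ([[0,1,0,-1],[-1,-2,1],[1]], [[0,0,-1],[0,1]]), ([[0,1],[-1,-1,-1]], [[1]]),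
      ([[0,1],[-1,-1]], [[1]]), ([[0,1,-1],[-1]], [[0,-1],[1]]), ([[0,-1,0,1],[1,2,-1],[-1]],
      [[0,0,1]]), ([[0,0,-1,1],[0,2,-1],[-1]], [[0,0,1]]), ([[0,-1,0,0,1],[1,2,1,-1],[-1,-1]],
      [[0,0,0,1]]), ([[0,0,-1,0,1],[0,2,2,-2],[-1,-3,1],[1]], [[0,0,0,1]]),
      ([[0,0,0,-1,1],[0,0,3,-2],[0,-3,1],[1]], [[0,0,0,1]]), ([[0,0,1],[0,-2,-1],[1,1]], [[0,1]]),
      ([[0,0,0,0,1],[0,0,0,-3],[0,0,4],[0,-3],[1]], [[1,0,0,1],[-1,0,-1]]),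
      ([[0,0,0,-1,0,1],[0,0,3,2,-3],[0,-3,-5,3],[1,4,-1],[-1]], [[0,0,0,0,1]]),
      ([[0,0,0,0,-1,1],[0,0,0,4,-3],[0,0,-6,3],[0,4,-1],[-1]], [[0,0,0,0,1]]),
      ([[0,0,1],[0,-2],[1]], [[0,1]]), ([[0,0,0,1],[0,0,-3,-1],[0,3,2],[-1,-1]], [[0,0,1]]),
      ([[0,0,0,0,0,1],[0,0,0,0,-4],[0,0,0,7],[0,0,-7],[0,4],[-1]], [[0,1,0,0,1],[0,-1,0,-1]]),
      ([[0,-6,0,0,-1,0,1],[6,12,6,10,8,2],[-6,-6,-12,-13],[0,4,9,-4],[-1,-5,1],[1]],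
      [[0,0,0,0,0,1]]),
      ([[0,-6,0,0,0,-1,1],[6,12,6,6,11,2],[-6,-6,-6,-16],[0,0,10,-4],[0,-5,1],[1]],
      [[0,0,0,0,0,1]])]
    members := [(42, [1,2,3,4,5,6]), (132, [1,3,7,4,5,6]), (14, [1,2,8,3,5,6,9]), (5,
      [1,2,8,10,3,6,9,9,11,12]), (2, [1,2,8,10,13,3,9,9,11,14,12,11,9,12,12,15,16]), (1,
      [1,2,8,10,13,17,3,9,9,11,14,18,12,11,9,11,14,9,12,12,15,19,16,15,12,12,15,12,16,16,16,20,21])] },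
  { F := [[0,1], [-1,-2,-2,-1,-1], [1,2,2,2,1]]
    k := 0
    b := [0,1,1,2]
    R := [([[0,1]], [[1]]), ([[0,-1,1],[1]], [[0,1]]), ([[0,1],[-1,-1]], [[1]]), ([[0,1],[-1]],
      [[1]]), ([[0,1],[-1,-1,-1]], [[1]]), ([[0,1,-1],[-1]], [[0,-1],[1,1]]),
      ([[0,-1,0,1],[1,2,0,-1],[-1,-1]], [[0,0,1]]), ([[0,0,-1,1],[0,2,0,-1],[-1,-1]], [[0,0,1]]),
      ([[0,1,1,-1],[-1,-5,0,1],[3,2]], [[1,1,-1],[-1,0,-1]]), ([[0,-1,1],[1],[0,1,-1],[-1]],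
      [[1,1],[-1,-2,-1,-2]]), ([[0,0,-1,1],[0,2,1,-2],[-1,-3,0,1],[1,1]], [[1,0,1],[-1,-1,-1,-1]]),
      ([[0,0,1],[0,-2,-1],[1,1]], [[0,1]]), ([[0,0,2,1,-1],[0,-3,-9,0,1],[1,9,5],[-2,-2]],
      [[2,2,1,-1],[-2,-4,-2,-4]]), ([[0,-1,-1,2],[1,5,-1,-3],[-3,-2,3,1],[0,-3,-2],[1,1]],
      [[1,2,2],[-1,-3,-4,-3,-3]]),
      ([[0,0,-8,1,4],[0,13,30,-9,-4],[-5,-44,-22,4],[16,27,7],[-5,-3]],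
      [[4,7,5,4],[-8,-11,-16,-9,-10],[4,4,4,4]])]
    members := [(56, [1,2,3,4,5]), (174, [1,3,4,6,5]), (19, [1,2,7,3,4,8]), (188, [1,3,4,6,5,3]),
      (7, [1,2,7,9,3,4,8,8,10,11]), (3, [1,2,7,9,12,3,4,8,8,10,13,11,10,8,11,11,14,15])] },
  { F := [[0,0,-1], [0,1,3,1,1,1], [0,-3,-2,-2,-2], [1,1,1,1]]
    k := 1
    b := [0,1,1,2,5,14]
    R := [([[0,1]], [[1]]), ([[0,-1,1],[1]], [[0,1]]), ([[0,0,1],[0,-2],[1]], [[0,1]]),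
      ([[0,1],[-1]], [[1]]), ([[0,1],[-1,-1,-1]], [[1]]), ([[0,1],[-1,-1]], [[1]]),
      ([[0,0,-1,0,1],[0,1,3,-2],[0,-3,1],[1]], [[0,0,0,1]]),
      ([[0,0,0,-1,1],[0,0,3,-2],[0,-3,1],[1]], [[0,0,0,1]]), ([[0,-1,1,0,1],[1,0,0,-2],[0,0,1]],
      [[0,1,0,1]]), ([[0,1,-1,0,1,1],[-1,0,0,-3,-6],[0,0,3,12],[0,-1,-11],[0,5],[-1]],
      [[0,0,1,1,1]]), ([[0,0,-4,0,0,-1,1],[0,4,12,4,9],[0,-12,-8,-18,-2],[4,4,14],[0,-5,1],[1]],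
      [[0,0,0,0,0,1]]), ([[0,0,0,1],[0,0,-3],[0,3],[-1]], [[0,0,1]]),
      ([[0,1,-1,1,0,1],[-1,0,-3,-1,-5],[0,3,2,8],[-1,-1,-5],[0,1]], [[0,0,1,0,1]]),
      ([[0,-1,-7,-5,2,0,1,1],[1,7,37,10,11,5,-2],[1,-34,-22,-22,-10,1],[11,11,11],[0,0,5],[0,-1]],
      [[0,1,2,3,1,1,1],[0,-2,-4,-3,-3,-2],[1,2,2,2,1]]),
      ([[0,-1,-5,-4,1],[1,6,22,11,9,8,3],[0,-20,-7,-14,-12,-4],[8,-3,1],[4,4,4],[0,0,1]],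
      [[0,1,1,1],[0,-2,-2,-2,-2,-1],[1,1,1,1]])]
    members := [(61, [1,2,3,4,5,6]), (21, [1,2,7,3,4,6,8]), (8, [1,2,7,9,3,4,8,8,10,11]), (4,
      [1,2,7,9,12,3,4,8,8,10,13,11,10,8,11,11,14,15])] },
  { F := [[0,-1], [1,2,2,1,1], [-1,-3,-2,-2], [1,1,1]]
    k := 0
    b := [0,1,1,2]
    R := [([[0,1]], [[1]]), ([[0,-1,1],[1]], [[0,1]]), ([[0,1],[-1]], [[1]]),
      ([[0,1,0,-1],[-1,-2,1],[1]], [[0,0,-1],[0,1]]), ([[0,1],[-1,-1]], [[1]]), ([[0,1,-1],[-1]],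
      [[0,-1],[1]]), ([[0,2,0,-1],[-2,-3],[1]], [[1,0,-1],[0,2],[-1]]),
      ([[0,-1,0,1],[1,2,-1],[-1]], [[0,0,1]]), ([[0,0,1],[0,-2,-1],[1,1]], [[0,1]]),
      ([[0,0,-1,1],[0,2,-1],[-1]], [[0,0,1]]), ([[0,-1,0,0,1],[1,2,2,-2],[-1,-3,1],[1]],
      [[0,0,0,1]]), ([[0,0,1],[0,-2],[1]], [[0,1]]), ([[0,0,-1,0,1],[0,2,2,-2],[-1,-3,1],[1]],
      [[0,0,0,1]]), ([[0,0,0,-1,1],[0,0,3,-2],[0,-3,1],[1]], [[0,0,0,1]])]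
    members := [(47, [1,2,3,4,5]), (146, [1,3,6,7,5]), (16, [1,2,8,3,9,10]), (6,
      [1,2,8,11,3,12,10,10,13,14])] },
  { F := [[0,1], [-1,-2,-2,-2], [1,2,3,2,1]]
    k := 0
    b := [0,1,1,2,5]
    R := [([[0,1]], [[1]]), ([[0,1],[-1,-1,-1]], [[1]]), ([[0,1],[-1,-1]], [[1]]), ([[0,1],[-1]],
      [[1]]), ([[0,-1,1],[1]], [[0,1]]), ([[0,1,-1],[-1]], [[0,-1],[1,1]]),
      ([[0,0,1],[0,-2,-2],[1,2,1]], [[1,1],[-1,-1,-1]]), ([[],[0,0,-1,1],[0,1]], [[1],[-1,-1,-1]]),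
      ([[0,-1,1],[1]], [[1,1],[-1,-1,-1]]), ([[0,0,1,-1],[0,-2,1],[1]], [[0,0,-1],[0,1,1]]),
      ([[0,0,-1,1],[0,2,0,-1],[-1,-1]], [[1,1,1],[-1,-2,-2]]), ([[0,0,1],[0,-2,-1],[1,1]],
      [[1,1],[-1,-1,-1]]), ([[0,0,-1,1],[0,2,0,-1],[-1,-1]], [[0,0,1]]),
      ([[0,0,1,-2,1],[0,-2,2],[1]], [[0,0,0,1]])]
    members := [(202, [1,2,3,4]), (66, [1,5,2,3,4]), (201, [1,3,4,6,2]), (184, [1,3,4,6,2,3]),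
      (210, [1,2,3,4,2,3]), (222, [1,2,3,4,2,3]), (23, [1,5,7,2,3,4,8]), (76, [1,5,6,2,3,4,9]),
      (28, [1,5,10,6,2,3,4,9,5,11]), (9, [1,5,7,12,2,3,4,8,8,13,14])] },
  { F := [[0,0,-1], [0,1,3,2,1], [0,-3,-4,-3,-1], [1,2,2,1]]
    k := 1
    b := [0,1,1,2,5,14]
    R := [([[0,1]], [[1]]), ([[0,-1,1],[1]], [[0,1]]), ([[0,0,1],[0,-2,-1],[1,1]], [[0,1]]),
      ([[0,1],[-1]], [[1]]), ([[0,1],[-1,-1]], [[1]]), ([[0,1,-1],[-1]], [[0,-1],[1,1]]),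
      ([[0,-1,1,1],[1,0,-3,-1],[0,3,2],[-1,-1]], [[0,1,1]]), ([[],[0,0,-1,1],[0,2,-1],[-1]],
      [[0,1],[0,-2,-1,-1],[1,1,1]]), ([[0,1],[-1,-1,-1]], [[1]]), ([[0,0,1,-1],[0,-2,1],[1]],
      [[0,0,-1],[0,1,1]]), ([[0,0,-1,2,-1],[0,2,-2],[-1]], [[0,0,0,-1],[0,0,1,1]]),
      ([[0,0,1],[0,-2],[1]], [[0,1]]), ([[0,0,-1,1],[0,2,-1],[-1]], [[0,0,1]]),
      ([[0,0,0,1],[0,0,-3,-1],[0,3,2],[-1,-1]], [[0,0,1]]),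
      ([[0,1,-1,2],[-1,1,-7,-5],[-1,6,11,3],[-2,-7,-4],[1,1]], [[0,1,1],[0,-2,0,0,1],[1,1,1]]),
      ([[0,-1,1,-3,2],[1,0,9,0,-2],[0,-9,-7,2],[3,6],[-1]],
      [[0,1,0,2],[0,-1,-1,-1,-1],[1,-1,0,-1],[1,1,1]])]
    members := [(70, [1,2,3,4,5]), (72, [1,2,3,5,4]), (81, [1,2,6,4,5]), (25, [1,2,7,3,4,8]), (85,
      [1,2,6,9,5,4]), (26, [1,2,7,3,5,4,8]), (33, [1,2,10,6,4,5,11]), (24, [1,2,7,3,12,4,13,8]),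
      (30, [1,2,10,6,3,4,13,11]), (37, [1,2,10,6,9,5,4,11]), (11, [1,2,7,14,3,4,8,8,15,16]), (12,
      [1,2,7,14,3,5,4,8,8,15,16]), (10, [1,2,7,14,3,12,4,13,8,15,8,16])] },
  { F := [[0,0,0,1], [0,0,-1,-4,-1,-1], [0,0,6,3,3], [0,-4,-3,-3], [1,1,1]]
    k := 2
    b := [0,1,1,2,5,14,42]
    R := [([[0,1]], [[1]]), ([[0,-1,1],[1]], [[0,1]]), ([[0,0,0,1],[0,0,-3],[0,3],[-1]],
      [[0,0,1]]), ([[0,0,1],[0,-2],[1]], [[0,1]]), ([[0,1],[-1]], [[1]]), ([[0,1],[-1,-1]], [[1]]),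
      ([[0,-1,0,1,1],[1,1,0,-3],[0,0,3],[0,-1]], [[0,1,1,1]]),
      ([[0,1,-1,0,1],[-1,0,0,-4],[0,0,6],[0,-4],[1]], [[0,0,1,1]]),
      ([[0,-1,1,1,1],[1,0,-3,-3],[0,3,3],[-1,-1]], [[0,1,1,1]]),
      ([[0,0,-1,1,-1],[0,2,-1,4,2],[-1,0,-6,-7],[0,4,9],[-1,-5],[1]], [[0,0,0,-1],[0,0,1,1,1]]),
      ([[0,-1,2,-16,0,0,1],[1,-1,15,60,14,9],[0,0,-90,-42,-30],[0,60,42,25],[-15,-14],[0,-6],[1]],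
      [[0,0,0,1,1,1]])]
    members := [(74, [1,2,3,4,5,6]), (27, [1,2,7,3,4,5,8]), (13, [1,2,7,9,3,4,5,8,8,10,11])] },
  { F := [[0,1], [-1,-2,-1,-1,-1], [1,1,0,0,-1], [0,2,4,3], [-1,-4,-3], [1,1]]
    k := 0
    b := [0,1,1,2]
    R := [([[0,1]], [[1]]), ([[0,1],[-1]], [[1]]), ([[0,1,-1],[-1]], [[0,-1],[1]]),
      ([[0,1],[-1,-2,-1],[1,1]], [[1]]), ([[0,1],[-1,-1]], [[1]]), ([[0,-1,1],[1]],
      [[0,1],[0,1],[-1]]), ([[0,-1,1],[1]], [[0,1]]), ([[0,0,1],[0,-2,-1],[1,1]], [[0,1]]),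
      ([[0,0,-1,1],[0,2,-1],[-1]], [[0,0,1],[0,0,1],[0,-1]]), ([[0,-1,0,1],[1,2,-1],[-1]],
      [[0,0,1],[0,0,1],[0,-1]]), ([[0,0,1],[0,-2],[1]], [[0,1]]), ([[0,0,-1,1],[0,2,-1],[-1]],
      [[0,0,1]]), ([[0,0,0,-1,1],[0,0,3,-2],[0,-3,1],[1]], [[0,0,0,1],[0,0,0,1],[0,0,-1]]),
      ([[0,0,-1,0,1],[0,2,2,-2],[-1,-3,1],[1]], [[0,0,0,1],[0,0,0,1],[0,0,-1]]),
      ([[0,0,0,1],[0,0,-3,-1],[0,3,2],[-1,-1]], [[0,0,1]])]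
    members := [(137, [1,2,3,4,5,6]), (44, [1,7,2,4,8,9,10]), (15, [1,7,10,2,8,11,12,13,14,15])] },
  { F := [[0,-1], [1,2,3,1], [-1,-4,-4,-1], [1,2,1]]
    k := 0
    b := [0,1,1,2,5]
    R := [([[0,1]], [[1]]), ([[0,1],[-1]], [[1]]), ([[0,1,-1],[-1]], [[0,-1],[1]]),
      ([[0,1],[-1,-1]], [[1]]), ([[0,1,-1],[-1]], [[0,-1],[1,1]]), ([[0,-1,1],[1]], [[0,1]]),
      ([[0,0,1],[0,-2,-1],[1,1]], [[0,1]]), ([[0,0,1],[0,-2,-1],[1,1]], [[1,1],[-1,-2,-1],[1,1]]),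
      ([[0,-1,1],[1]], [[1,1],[-1,-2,-1],[1,1]]), ([[0,0,1],[0,-1,-1]], [[1,1],[-1,-2,-1],[1,1]]),
      ([[0,0,-1,1],[0,2,0,-1],[-1,-1]], [[0,0,1],[0,-2],[1]]), ([[0,-1,0,1],[1,2,0,-1],[-1,-1]],
      [[0,0,1]]), ([[0,0,1],[0,-2],[1]], [[0,1]]), ([[0,0,-1,1],[0,2,-1],[-1]], [[0,0,1]]),
      ([[],[0,-1,1],[1]], [[1],[-1,-2,-1],[1,1]]), ([[0,0,-1,1],[0,2,-1],[-1]],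
      [[1,1,1],[-1,-3,-1],[1,1]]), ([[0,0,1,-1],[0,-2,1],[1]], [[0,0,-1],[0,1,1]]),
      ([[],[0,0,-1,1],[0,2,-1],[-1]], [[1],[-1,-2],[1,1]]), ([[0,-1,1],[1,1,-1],[-1]],
      [[0,1],[0,-1,-1],[0,1]]), ([[0,0,-1,1],[0,2,0,-1],[-1,-1]], [[0,1,1],[0,-1,-2,-1],[0,1,1]]),
      ([[0,1,-1],[-1,-1,1],[1]], [[0,-1],[1,1,1],[-1,-2],[1]]), ([[0,0,1,-1],[0,-2,0,1],[1,1]],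
      [[0,-1,-1],[1,2,2,1],[-1,-3,-2],[1,1]])]
    members := [(151, [1,2,3,4]), (154, [1,2,3,4]), (179, [1,4,2,5]), (181, [1,4,2,5]), (194,
      [1,4,2,5]), (196, [1,4,2,5]), (58, [1,6,4,2,7]), (59, [1,6,4,2,7]), (78, [1,6,5,7,2]), (152,
      [1,2,3,4,4]), (153, [1,2,3,4,4]), (166, [1,2,3,5,4]), (180, [1,4,2,5,4]), (193, [1,4,2,5,4]),
      (49, [1,6,2,8,4,9]), (79, [1,6,5,7,4,2]), (149, [1,2,3,10,4,11]), (150, [1,2,3,10,4,11]),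
      (97, [1,6,3,8,4,2,9]), (20, [1,6,12,4,2,13,14,15]), (93, [1,6,3,5,7,4,2,16]), (29,
      [1,6,17,5,7,13,2,14,18]), (17, [1,6,12,2,7,4,15,15,19,20]), (99,
      [1,6,3,8,10,4,2,9,9,11,21,22])] },
  { F := [[0,0,1], [0,-1,-3,-2,-1], [0,3,5,3], [-1,-4,-3], [1,1]]
    k := 1
    b := [0,1,1,2]
    R := [([[0,1]], [[1]]), ([[0,-1,1],[1]], [[0,1]]), ([[0,0,1],[0,-2],[1]], [[0,1]]),
      ([[0,1],[-1]], [[1]]), ([[0,0,1],[0,-2,-1],[1,1]], [[0,1]]),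
      ([[0,-1,1,1],[1,0,-3],[0,3],[-1]], [[0,1,1],[0,-1]]), ([[0,0,-1,1],[0,2,-1],[-1]],
      [[0,0,1]]), ([[0,1,-1],[-1]], [[0,-1],[1]]), ([[0,1],[-1,-1]], [[1]]),
      ([[0,0,-1,0,1],[0,1,3,-2],[0,-3,1],[1]], [[0,0,0,1]]),
      ([[0,0,0,-1,1],[0,0,3,-2],[0,-3,1],[1]], [[0,0,0,1]]), ([[0,0,0,1],[0,0,-3],[0,3],[-1]],
      [[0,0,1]]), ([[0,1,-3,1,2],[-1,3,3,-7],[-1,-5,8],[2,-4],[1]], [[0,0,1,2],[0,0,-1,-1]]),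
      ([[0,1,-1,0,1],[-1,0,0,-4],[0,0,6],[0,-4],[1]], [[0,1,1,1],[0,-2,-2,-1],[1,3,2],[-1,-1]])]
    members := [(63, [1,2,3,4,5]), (50, [1,2,4,6,3,7]), (107, [1,2,8,4,5,9]), (22,
      [1,2,10,3,4,7,11]), (101, [1,2,8,6,5,4,7,2]), (18, [1,2,10,4,12,3,11,11,13,14])] },
  { F := [[0,0,-1], [0,1,3,3], [0,-3,-6,-3], [1,3,3,1]]
    k := 1
    b := [0,1,1,2,5,14]
    R := [([[0,1]], [[1]]), ([[0,-1,1],[1]], [[0,1]]), ([[0,1,-1],[-1]], [[0,-1],[1,1]]),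
      ([[0,1],[-1,-1]], [[1]]), ([[0,1],[-1]], [[1]]), ([[0,1,-1],[-1]], [[0,-1],[1]]),
      ([[0,0,1,-1],[0,-2,0,1],[1,1]], [[0,0,-1],[0,1]]), ([[0,0,1,-1],[0,-2,1],[1]],
      [[0,0,-1],[0,1,1]]), ([[0,0,-1,2,-1],[0,2,-2],[-1]], [[0,0,0,-1],[0,0,1,1]]),
      ([[0,1,1,-1],[-1,-2,-1]], [[1,0,-1],[0,1,1]]), ([[0,0,0,-1,1],[0,0,1]],
      [[0,1,1,1],[0,-2,-4,-1],[1,3,2]]), ([[0,0,1],[0,-2,-1],[1,1]], [[0,1]]),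
      ([[0,0,-1,1],[0,2,0,-1],[-1,-1]], [[0,0,1]]), ([[0,0,-1,1],[0,1]], [[0,0,1],[0,-2],[1]])]
    members := [(83, [1,2,3,4,5]), (109, [1,2,6,4,5,7]), (35, [1,2,8,3,4,5,9]), (113,
      [1,2,6,10,4,5,7]), (104, [1,2,6,5,10,4,7,11]), (31, [1,2,8,3,12,4,5,13,9]), (118,
      [1,2,6,14,10,4,5,7,11])] },
  { F := [[0,0,0,1], [0,0,-1,-4,-2], [0,0,6,6,1], [0,-4,-6,-2], [1,2,1]]
    k := 2
    b := [0,1,1,2,5,14]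
    R := [([[0,1]], [[1]]), ([[0,-1,1],[1]], [[0,1]]), ([[0,1,-1],[-1]], [[0,-1],[1,1]]),
      ([[0,0,1],[0,-2],[1]], [[0,1]]), ([[0,1],[-1]], [[1]]), ([[0,0,1],[0,-2,-1],[1,1]], [[0,1]]),
      ([[0,1,-1],[-1]], [[0,-1],[1]]), ([[0,1],[-1,-1]], [[1]]), ([[0,0,-1,1],[0,1]],
      [[0,0,1],[0,-2],[1]]), ([[0,0,1,-1],[0,-2,1],[1]], [[0,0,-1],[0,1,1]]),
      ([[0,0,-1,2,-1],[0,2,-2],[-1]], [[0,0,0,-1],[0,0,1,1]]), ([[0,0,1,-1],[0,-2,0,1],[1,1]],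
      [[0,0,-1],[0,1]]), ([[0,0,-1,1],[0,2,-1],[-1]], [[0,0,1]]), ([[0,1,1,-1],[-1,-2,-1]],
      [[1,0,-1],[0,2],[-1]]), ([[0,0,0,1],[0,0,-3],[0,3],[-1]], [[0,0,1]]),
      ([[0,0,0,-1,1],[0,0,3,-2],[0,-3,1],[1]], [[0,0,0,1]])]
    members := [(84, [1,2,3,4,5]), (87, [1,2,3,6,5]), (115, [1,2,7,6,5]), (88, [1,2,3,6,8,5]),
      (116, [1,2,7,6,8,5]), (125, [1,2,7,9,8,5]), (36, [1,2,10,3,4,5,11]), (39, [1,2,10,3,6,5,11]),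
      (111, [1,2,7,4,5,8,12]), (123, [1,2,7,9,5,8,12]), (34, [1,2,10,3,5,4,13,11]), (40,
      [1,2,10,3,6,8,5,11]), (127, [1,2,7,9,14,8,5,12]), (32, [1,2,10,3,15,4,5,16,11]), (38,
      [1,2,10,3,6,4,5,13,11])] },
  { F := [[0,0,0,0,-1], [0,0,0,1,5,1], [0,0,0,-10,-4], [0,0,10,6], [0,-5,-4], [1,1]]
    k := 3
    b := [0,1,1,2,5]
    R := [([[0,1]], [[1]]), ([[0,-1,1],[1]], [[0,1]]), ([[0,1,-1],[-1]], [[0,-1],[1,1]]),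
      ([[0,0,0,1],[0,0,-3],[0,3],[-1]], [[0,0,1]]), ([[0,0,1],[0,-2],[1]], [[0,1]]), ([[0,1],[-1]],
      [[1]]), ([[0,1,-1],[-1]], [[0,-1],[1]]), ([[0,0,-1,1],[0,1]], [[0,0,1],[0,-2],[1]]),
      ([[0,0,1],[0,-2,-1],[1,1]], [[0,1]]), ([[0,1],[-1,-1]], [[1]]), ([[0,0,1,-1],[0,-2,1],[1]],
      [[0,0,-1],[0,1,1]]), ([[0,1,-1,0,1],[-1,0,0,-4],[0,0,6],[0,-4],[1]], [[0,0,1,1]])]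
    members := [(89, [1,2,3,4,5,6]), (117, [1,2,7,4,5,6]), (126, [1,2,7,8,5,6]), (129,
      [1,2,7,8,9,6]), (130, [1,2,7,8,9,10,6]), (41, [1,2,11,3,4,5,6,12])] },
  -- Here label 1 is b + x, so b is the avoider series without its first term and starts with 0, 0,
  -- 1.
  { F := [[0,1], [0,-2,-2,-1,-1], [-1,-1,0,-2,0,1], [0,0,-3,-2,0,1], [0,-1,-1,0,3,2], [0,0,0,1,1]]
    k := 0
    b := [0,0,1,2,5]
    R := [([[0,1],[1]], [[1]]), ([[0,-1]], [[-1]]), ([[0,1,-1],[0,-2],[-1]], [[0,-1]]),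
      ([[0,1],[0,-1,-2],[-1,-3],[-1]], [[1],[0,-1]]), ([[0,1],[0,-2],[-1]], [[1]]),
      ([[0,1,-1],[0,-2,0,1],[-1,0,1,-2],[0,0,-3],[0,-1]], [[0,-1],[0,0,1]]),
      ([[0,1,-1,1],[0,-2,0,0,-2],[-1,0,0,-5],[0,0,-4],[0,-1]], [[0,0,1],[0,0,0,-1]]),
      ([[0,1],[0,-2,-2],[-1,-1,1],[0,0,-2],[0,-1]], [[1],[0,-1]]),
      ([[0,1,-1],[0,-2,0,1],[-1,0,1,-2],[0,0,-3],[0,-1]], [[0,-1],[-1,0,1]]),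
      ([[0,1,-1],[0,-2],[-1]], [[0,-1],[-1]]), ([[0,0,-1]], [[0,-1],[-1]]),
      ([[0,1,-1],[0,-2,0,1],[-1,0,1,-2],[0,0,-3],[0,-1]], [[0,-1],[-1,0,1],[0,1]]),
      ([[0,0,1],[0,0,-1,-2],[0,-1,-3],[0,-1]], [[0,1],[1,0,-1],[0,-1]]),
      ([[0,1,-1,1],[0,-2,0,0,-2],[-1,0,0,-5],[0,0,-4],[0,-1]], [[0,0,1],[0,1,0,-1],[0,0,-1]]),
      ([[0,0,1],[0,0,-2],[0,-1]], [[0,1],[1]]), ([[0,-1,1,-1],[0,2,0,0,2],[1,0,0,5],[0,0,4],[0,1]],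
      [[0,0,-1],[0,-2,-1,1],[-1,-1,2,1],[0,1,1]]),
      ([[0,0,-1,-1],[0,1,1,3,2],[0,-1,2,3],[-1,0,2],[0,0,-2],[0,-1]],
      [[0,-1,-1],[-1,-2,0,1],[-1,-1,2,1],[-1,1,1]])]
    members := [(134, [1,2,3,4,5,6,7,8,9]), (43, [1,10,2,4,5,11,12,13,14,8,15,16,17])] },
  { F := [[0,1], [-1,-2,-2,-1], [1,2,1,-2], [0,2,8,5], [-1,-6,-7,-2], [1,2,1]]
    k := 0
    b := [0,1,1,2,5]
    R := [([[0,1]], [[1]]), ([[0,1],[-1]], [[1]]), ([[0,1,-1],[-1]], [[0,-1],[1]]),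
      ([[0,0,-1],[0,2,3],[-1,-4,-2],[1,1]], [[0,-1],[1]]), ([[0,1],[-1,-1]], [[1]]),
      ([[0,0,1,-1],[0,-2,0,1],[1,1]], [[0,0,-1],[0,1,-1],[0,2,1],[-1,-1]]), ([[0,1,-1],[-1]],
      [[0,-1],[1,1]]), ([[0,1],[-1,-2],[1]], [[1]]), ([[0,0,1],[0,-2,-2],[1,3],[-1]],
      [[1,1],[-1,-1]]), ([[0,-1,1],[1]], [[0,1]]), ([[0,0,1],[0,-2],[1]], [[0,1]]),
      ([[0,0,-1,1],[0,2,-1],[-1]], [[0,0,1],[0,0,1],[0,-1,-1]]), ([[0,0,1],[0,-2,-2],[1,3],[-1]],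
      [[0,1]]), ([[0,0,1],[0,-2,-1],[1,1]], [[0,1]]), ([[0,0,1,-1],[0,-2,0,1],[1,1]],
      [[0,0,-1],[0,1]]), ([[0,0,-1,1],[0,2,0,-1],[-1,-1]], [[0,0,1],[0,0,1],[0,-1,-1]]),
      ([[0,1],[-1,-2,-2,-2],[1,2,4,2],[0,-1,-1]], [[],[0,0,-1],[0,1]]),
      ([[0,-1,1,-1],[1,0,1,4],[0,1,-4,-3],[-1,0,1]], [[0,0,-1],[0,1],[0,0,1],[0,-1]])]
    members := [(139, [1,2,3,4,5,6]), (140, [1,2,3,4,5,6]), (176, [1,5,2,7,8,9]), (190,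
      [1,5,2,7,8,9]), (57, [1,10,5,2,8,11,12,13]), (45, [1,10,2,4,14,5,15,16,17,18])] },
  { F := [[0,0,0,1], [0,0,-1,-3,-1,-1], [0,0,3,2,0,-2], [0,-1,-1,6,9], [0,0,-9,-16], [0,5,14], [-1,-6],
      [1]]
    k := 2
    b := [0,1,1,2,5,14]
    R := [([[0,1]], [[1]]), ([[0,-1,1],[1]], [[0,1]]), ([[0,0,1],[0,-2],[1]], [[0,1]]),
      ([[0,1],[-1]], [[1]]), ([[0,1],[-1,-2],[1]], [[1]]), ([[0,0,-1,1],[0,2,-1],[-1]],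
      [[0,0,1],[0,0,1],[0,-2],[1]]), ([[0,0,1],[0,-2,-2],[1,3],[-1]], [[0,1]]),
      ([[0,0,0,1],[0,0,-3],[0,3],[-1]], [[0,0,1]]), ([[0,0,-1,1],[0,2,-1],[-1]], [[0,0,1]]),
      ([[0,-1,1,-1],[1,0,3,2],[0,-3,-5],[1,4],[-1]], [[0,0,-1],[0,1]]),
      ([[0,0,1],[0,-1,-3,-1,-2],[0,3,2,5],[-1,-1,-4],[0,1]], [[],[0,0,0,-1],[0,0,1]]),
      ([[0,1,-1,1],[-1,0,-3,-2],[0,3,5],[-1,-4],[1]], [[0,0,1]])]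
    members := [(62, [1,2,3,4,5,6,7]), (46, [1,2,4,7,8,3,9,10,11,12])] },
  { F := [[0,1], [-1,-2,-2,-2], [1,3,5], [-1,-4], [1]]
    k := 0
    b := [0,1,1,2]
    R := [([[0,1]], [[1]]), ([[0,1],[-1]], [[1]]), ([[0,1,-1],[-1]], [[0,-1],[1]]),
      ([[0,1],[-1,-2],[1]], [[1]]), ([[0,-1,1],[1]], [[0,1]]), ([[0,1,0,-1],[-1,-2,1],[1]],
      [[0,0,-1],[0,1]]), ([[0,0,1],[0,-2],[1]], [[0,1]])]
    members := [(148, [1,2,3,4]), (48, [1,5,2,6,7]), (100, [1,5,3,6,4,7,2])] },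
  { F := [[0,-1], [1,2,3,1], [-1,-4,-3,-2], [1,1,1]]
    k := 0
    b := [0,1,1,2,5,14]
    R := [([[0,1]], [[1]]), ([[0,1],[-1]], [[1]]), ([[0,1,-1],[-1]], [[0,-1],[1]]),
      ([[0,1,-1],[-1]], [[0,-1],[1,2],[-1]]), ([[0,1],[-1,-1]], [[1]]), ([[0,1,-1],[-1]],
      [[0,-1],[1,1]]), ([[0,1],[-1,-2],[1]], [[1]]), ([[0,-1,1],[1]], [[0,1]]),
      ([[0,0,1],[0,-2],[1]], [[0,1]]), ([[0,0,-1,1],[0,2,1,-2],[-1,-3,1],[1]],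
      [[0,0,1],[0,-2,-1],[1,1]]), ([[0,0,1],[0,-2,-1],[1,1]], [[1,1],[-1,-2],[1]]),
      ([[0,0,-1,1],[0,1]], [[1,1,1],[-1,-3,-2],[1,1]]), ([[0,0,1,-1],[0,-2,-1,2],[1,3,-1],[-1]],
      [[0,0,-1],[0,1,1]])]
    members := [(155, [1,2,3,4,5]), (156, [1,2,3,4,5]), (185, [1,5,2,6,7]), (199, [1,5,2,6,7]),
      (204, [1,4,5,2,7]), (209, [1,4,5,2,7]), (212, [1,7,2,4,5]), (67, [1,8,4,5,2,9]), (68,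
      [1,8,7,9,2,5]), (162, [1,2,3,6,7,10]), (51, [1,8,2,11,4,5,12]), (77, [1,8,6,7,9,2,13])] },
  { F := [[0,1], [-1,-2,-4], [1,6,4], [-2,-4], [1]]
    k := 0
    b := [0,1,1]
    R := [([[0,1]], [[1]]), ([[0,1],[-1,-2],[1]], [[1]]), ([[0,1],[-1]], [[1]]), ([[0,1,-1],[-1]],
      [[0,-1],[1]]), ([[0,-1,1],[1]], [[0,1]]), ([[0,0,1],[0,-2],[1]], [[0,1]]),
      ([[0,0,1],[0,-2,-2],[1,3],[-1]], [[0,1]]), ([[0,0,-1,1],[0,2,-1],[-1]],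
      [[0,1,1],[0,-1,-2],[0,1]])]
    members := [(214, [1,2,3]), (157, [1,3,4,2]), (69, [1,5,2,6,3]), (52, [1,5,3,7,2,6,8]), (96,
      [1,5,4,7,3,6,8])] },
  { F := [[0,0,1], [0,-1,-3,-3], [0,3,7,2], [-1,-5,-3], [1,1]]
    k := 1
    b := [0,1,1,2,5,14]
    R := [([[0,1]], [[1]]), ([[0,-1,1],[1]], [[0,1]]), ([[0,1,-1],[-1]], [[0,-1],[1,2],[-1]]),
      ([[0,1],[-1]], [[1]]), ([[0,0,1],[0,-2],[1]], [[0,1]]), ([[0,1,-1],[-1]], [[0,-1],[1,1]]),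
      ([[0,0,1,-1],[0,-2,1],[1]], [[0,0,-1],[0,1,2],[0,-1]]), ([[0,0,-1,1],[0,2,-1],[-1]],
      [[0,1,1],[0,-2,-2],[1,3],[-1]]), ([[0,1],[-1,-1]], [[1]]), ([[0,1],[-1,-2],[1]], [[1]]),
      ([[0,1,-1],[-1]], [[0,-1],[1]]), ([[0,0,-1,1],[0,1]], [[0,1,1],[0,-2,-2],[1,3],[-1]]),
      ([[0,0,-1,1],[0,2,-1],[-1]], [[0,1,1],[0,-2,-1],[1,1]]), ([[0,0,-1,1],[0,1]],
      [[0,0,1],[0,-2],[1]]), ([[0,0,0,1],[0,0,-3],[0,3],[-1]], [[0,0,1]]),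
      ([[0,0,-1,1],[0,2,-1],[-1]], [[0,0,1]]), ([[0,0,1,-1],[0,-2,1],[1]], [[0,0,-1],[0,1,1]]),
      ([[0,1,0,-1],[-1,-1]], [[0,-2,-1],[1,2,2],[-1,-3],[1]]),
      ([[0,0,-1,1],[0,2,1,-2],[-1,-3,1],[1]], [[0,0,1]])]
    members := [(71, [1,2,3,4,5]), (82, [1,2,6,4,5]), (53, [1,2,4,7,3,8]), (73, [1,2,3,9,4,5]),
      (86, [1,2,6,10,5,4]), (106, [1,2,11,4,3,12]), (110, [1,2,11,9,4,5]), (114, [1,2,11,10,5,4]),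
      (54, [1,2,4,7,3,9,8]), (105, [1,2,11,4,10,5,13]), (120, [1,2,11,14,3,4,12]), (60,
      [1,2,9,4,15,5,16,3]), (64, [1,2,5,4,3,9,12,3]), (80, [1,2,6,15,5,4,16,17]), (98,
      [1,2,11,7,5,4,8,2]), (119, [1,2,11,14,10,5,4,13]), (102, [1,2,11,7,3,9,4,8,12]), (121,
      [1,2,11,14,3,9,4,12,18]), (94, [1,2,11,6,15,5,4,16,2,19])] },
  { F := [[0,0,0,-1], [0,0,1,4,2], [0,0,-6,-7], [0,4,9], [-1,-5], [1]]
    k := 2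
    b := [0,1,1,2,5]
    R := [([[0,1]], [[1]]), ([[0,-1,1],[1]], [[0,1]]), ([[0,1,-1],[-1]], [[0,-1],[1,2],[-1]]),
      ([[0,0,1],[0,-2],[1]], [[0,1]]), ([[0,1],[-1]], [[1]]), ([[0,1,-1],[-1]], [[0,-1],[1]]),
      ([[0,0,-1,1],[0,1]], [[0,0,1],[0,-2],[1]]), ([[0,-1,1,1],[1,0,-3],[0,3],[-1]],
      [[0,1,1],[0,-1]]), ([[0,0,0,-1,1],[0,0,3,-2],[0,-3,1],[1]], [[0,0,0,1]]),
      ([[0,1],[-1,-2],[1]], [[1]]), ([[0,0,-1,1],[0,2,-1],[-1]], [[0,0,1]])]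
    members := [(75, [1,2,3,4,5]), (112, [1,2,6,4,5]), (124, [1,2,6,7,5,4]), (55, [1,2,5,8,3,4,9]),
      (128, [1,2,6,7,10,4,5]), (103, [1,2,6,8,3,4,5,9,11])] },
  { F := [[0,0,0,-1], [0,0,1,3,3], [0,0,-3,-9], [0,1,10], [0,-5], [1]]
    k := 2
    b := [0,1,1,2,5]
    R := [([[0,1]], [[1]]), ([[0,-1,1],[1]], [[0,1]]), ([[0,0,1],[0,-2],[1]], [[0,1]]),
      ([[0,1],[-1]], [[1]]), ([[0,-1,1,1],[1,0,-2],[0,1]], [[0,1,1],[0,-2],[1]]), ([[0,1,-1],[-1]],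
      [[0,-1],[1]]), ([[0,0,-1,1],[0,1]], [[0,0,1],[0,-2],[1]])]
    members := [(65, [1,2,3,4,5]), (108, [1,2,6,4,5,3]), (122, [1,2,6,7,5,3,4])] },
  { F := [[0,0,0,1], [0,0,-3,-2,-4], [0,3,5,12,6], [-1,-4,-12,-12,-4], [1,4,6,4,1]]
    k := 4
    b := [0,1,1,2,5,14,42]
    R := [([[0,1]], [[1]]), ([[0,1],[-1]], [[1]]), ([[0,1,-1],[-1]], [[0,-1],[1]]),
      ([[0,1,-1],[-1]], [[0,-1],[1,1]]), ([[0,0,-1],[0,2,2],[-1,-2,-1]], [[0,-1],[1]]),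
      ([[0,1],[-1,-1]], [[1]]), ([[0,-1,1],[1]], [[0,1]]), ([[0,0,1,-1],[0,-2,0,1],[1,1]],
      [[0,0,-1],[0,1]]), ([[0,-1,1,-1],[1,0,3,2],[0,-3,-4,-1],[1,2,1]], [[0,0,-1],[0,1],[0,1]]),
      ([[0,0,1,-2,1],[0,-2,2],[1]], [[0,0,0,1],[0,0,-2,-1],[0,1,1]])]
    members := [(172, [1,2,3,4,5,6]), (173, [1,2,3,4,5,6]), (90, [1,7,3,4,5,6,2,8,9,10])] },
  { F := [[0,0,1], [0,-2,-2,-4], [1,3,9,5], [-1,-6,-7,-2], [1,2,1]]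
    k := 2
    b := [0,1,1,2,5,14,42]
    R := [([[0,1]], [[1]]), ([[0,1],[-1]], [[1]]), ([[0,1,-1],[-1]], [[0,-1],[1]]),
      ([[0,1,-1],[-1]], [[0,-1],[1,2],[-1]]), ([[0,1],[-1,-1]], [[1]]), ([[0,1,-1],[-1]],
      [[0,-1],[1,1]]), ([[0,1],[-1,-2],[1]], [[1]]), ([[0,-1,1],[1]], [[0,1]]),
      ([[0,0,1],[0,-2,-1],[1,1]], [[0,1]]), ([[0,0,1,-1],[0,-2,0,1],[1,1]], [[0,0,-1],[0,1]]),
      ([[0,0,1,-2,1],[0,-2,2],[1]], [[0,0,0,1],[0,0,-2,-1],[0,1,1]]), ([[0,0,1],[0,-3],[2,1]],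
      [[1,1],[-1,-2],[1]]), ([[0,0,2,-3,1],[0,-4,2,1],[2,1]],
      [[0,-1,-1,1],[1,2,1,-2],[-1,-3,1],[1]]), ([[0,0,1],[0,-2],[1]], [[0,1]]),
      ([[0,0,1,-1],[0,-2,-1,2],[1,3,-1],[-1]], [[0,0,-1],[0,1]])]
    members := [(158, [1,2,3,4,5]), (159, [1,2,3,4,5]), (167, [1,2,3,6,5]), (168, [1,2,3,6,5]),
      (171, [1,2,3,6,7]), (92, [1,8,3,6,9,2,10,11]), (95, [1,8,3,12,2,5,10,13]), (91,
      [1,8,3,6,7,14,2,15,11])] },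
  { F := [[0,1], [-1,-2,-3,-1], [1,4,5,2,1], [-1,-4,-6,-9,-5], [1,5,16,18,8,2], [-1,-8,-15,-17,-16,-7],
      [1,3,12,28,27,9], [0,-5,-20,-30,-20,-5], [1,5,10,10,5,1]]
    k := 0
    b := [0,1,1,2,5,14]
    R := [([[0,1]], [[1]]), ([[0,1],[-1,-1]], [[1]]), ([[0,1],[-1]], [[1]]), ([[0,1,-1],[-1]],
      [[0,-1],[1,1]]), ([[0,1],[-1,-1,-1]], [[1],[0,-1],[1,1]]),
      ([[0,1,-1],[-1,0,0,1],[0,0,-2,-2],[0,1,2,1]], [[0,-1],[1,1,1],[0,-2,-2],[1,2,1]]),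
      ([[0,0,0,1],[0,-1,-1,-1,-1],[1,1,1],[0,0,2,2],[0,-1,-2,-1]],
      [[0,1,1],[0,-1,-2,-1],[0,2,4,2],[-1,-3,-3,-1]]),
      ([[0,1],[-1,-2,-1],[1,1,1],[0,-2,-2],[1,2,1]], [[1],[0,-1],[1,1]]),
      ([[0,0,1],[0,-2,-2,-1],[1,3,2,1],[-1,-1,-3,-2],[0,3,4,1],[-1,-2,-1]],
      [[1,1],[-1,-2,-1],[1,3,2],[-1,-2,-1]]), ([[0,1,-1],[-1]], [[0,-1],[1]]),
      ([[0,0,-1],[0,2,2,1],[-1,-2,-2,-1]], [[0,-1],[1,0,1],[0,-2,-1],[1,1]]),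
      ([[0,0,-1],[0,2,2],[-1,-2,-1]], [[0,-1],[1]]),
      ([[0,0,-1,1],[0,2,0,-1,-1],[-1,-1,0,3,3],[0,0,-3,-6,-3],[0,1,3,3,1]],
      [[0,0,1],[0,-2,0,-1],[1,0,3,1],[0,-3,-2],[1,1]]),
      ([[0,1,-1,1],[-1,0,-3,-1,-1],[0,3,2,1,1],[-1,-1]],
      [[0,0,1],[0,-2,0,-1],[1,0,3,1],[0,-3,-2],[1,1]]),
      ([[0,1,-1,0,1],[-1,0,1,-2,-3,-1],[0,-2,-1,1,3,2],[1,2,6,6,0,-1],[0,-4,-9,-6,-1],[1,3,3,1]],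
      [[0,-1,0,1],[1,0,0,1,-1],[0,-2,-3,1],[1,3,1,2,2],[-1,-1,-3,-4,-1],[0,1,2,1]]),
      ([[0,1],[-1,-2,-3],[1,4,2,-2,-2],[-1,-1,3,6,3],[0,-1,-3,-3,-1]],
      [[],[0,0,1],[0,-2,-1,-2],[1,2,5,1],[-1,-4,-2],[1,1]])]
    members := [(189, [1,2,3,4,5,6,7,8,9]), (135, [1,3,10,11,12,2,13,14,15,16]), (136,
      [1,3,10,11,12,2,13,14,15,16]), (175, [1,2,3,4,5,2,6,7,8,9])] },
  { F := [[0,1], [-1,-2,-2,-1], [1,3,2,-2,-1], [-1,-1,5,3], [0,-4,-3], [1,1]]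
    k := 0
    b := [0,1,1]
    R := [([[0,1]], [[1]]), ([[0,1],[-1]], [[1]]), ([[0,1,-1],[-1]], [[0,-1],[1]]),
      ([[0,1],[-1,-2,-1],[1,1]], [[1],[0,-1],[1]]), ([[0,1],[-1,-1]], [[1]]), ([[0,-1,1],[1]],
      [[0,1],[0,1],[-1]]), ([[0,1],[-1,-1,-1]], [[1]]), ([[0,-1,1],[1,0,1,-1],[0,-2,1],[1]],
      [[0,1],[0,1],[-1]]), ([[0,1],[-1,-2,-1],[1,1]], [[1]])]
    members := [(138, [1,2,3,4,5,6]), (147, [1,2,3,7,5,8,9])] },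
  { F := [[0,-1], [1,2,2,1], [-1,-2,0,1,1], [0,-3,-6,-7,-4,-1], [1,3,5,5,3,1]]
    k := 0
    b := [0,1,1,2,5]
    R := [([[0,1]], [[1]]), ([[0,1,-1],[-1]], [[0,-1],[1,1,1]]), ([[0,1],[-1,-1]], [[1]]),
      ([[0,1],[-1]], [[1]]), ([[0,1],[-1,-1,-1]], [[1]]), ([[0,0,1],[0,-2,-1],[1,1]],
      [[1,1],[-1,-1,-1]]), ([[0,1,-1],[-1]], [[0,-1],[1]]), ([[0,0,-1],[0,2,2,1],[-1,-2,-2,-1]],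
      [[0,-1],[1]]), ([[0,0,1,-1],[0,-2,0,0,1],[1,1,1]], [[0,0,-1],[0,1,-1],[0,2,1,1],[-1,-1,-1]])]
    members := [(217, [1,2,3,4,5,6]), (141, [1,4,7,8,5,3,9]), (203, [1,5,3,4,2,3,6])] },
  { F := [[0,-1], [1,2,4], [-1,-6,-3,-1], [2,2,3,0,-2], [0,-3,-3,1,1], [1,2,1]]
    k := 0
    b := [0,1,1,2]
    R := [([[0,1]], [[1]]), ([[0,1],[-1,-1,-1]], [[1],[0,-1],[1,1]]), ([[0,1],[-1,-1]], [[1]]),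
      ([[0,1],[-1]], [[1]]), ([[0,0,1],[0,-2,-1,-1],[1,1,1]], [[0,1],[0,1,-1],[-1]]),
      ([[0,1,-1],[-1]], [[0,-1],[1]]), ([[0,-1,-1,1],[1,4,3,0,-1],[-2,-5,-3],[1,1]],
      [[0,-1,1],[1,-1,2,-1],[0,-4],[2,1]]), ([[0,1],[-1,-2,-3],[1,4,2],[-1,-1]],
      [[1],[-1,-3],[2,1]]), ([[0,0,1,-1],[0,-2,0,0,1],[1,1,1]],
      [[0,0,-1],[0,1,-1,1],[0,2,-1],[-1]]), ([[0,1,-1],[-1]], [[0,-1],[1,1]]),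
      ([[0,0,1],[0,-2,-1,-1],[1,1,1]], [[1,1],[-1,-2,-1],[1,1]])]
    members := [(208, [1,2,3,4,5]), (142, [1,4,6,7,2,3,8,9]), (197, [1,3,4,10,2,3,11,5]), (206,
      [1,2,3,4,2,3,5,5]), (218, [1,2,3,4,2,3,5,5])] },
  { F := [[0,-1], [1,2,3], [-1,-4,0,3], [1,-2,-11,-8], [1,9,14,4], [-2,-7,-4], [1,1]]
    k := 0
    b := [0,1,1,2,5]
    R := [([[0,1]], [[1]]), ([[0,1],[-1]], [[1]]), ([[0,1,-1],[-1]], [[0,-1],[1]]),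
      ([[0,0,-1],[0,2,3],[-1,-4,-2],[1,1]], [[0,-1],[1]]), ([[0,1],[-1,-2],[1]], [[1]]),
      ([[0,0,1,-1],[0,-2,-1,2],[1,3,-1],[-1]], [[0,0,-1],[0,1,-1],[0,2,2],[-1,-3],[1]]),
      ([[0,1,-1],[-1]], [[0,-1],[1,2],[-1]]), ([[0,1],[-1,-1]], [[1]]), ([[0,0,1],[0,-2,-1],[1,1]],
      [[1,1],[-1,-2],[1]])]
    members := [(143, [1,2,3,4,5,6]), (213, [1,5,2,7,8,9])] },
  { F := [[0,0,0,-1], [0,0,3,2,3], [0,-3,-5,-9,-1,3], [1,4,9,-1,-15,-9], [-1,-3,6,27,29,10],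
      [0,-5,-20,-30,-20,-5], [1,5,10,10,5,1]]
    k := 4
    b := [0,1,1,2,5]
    R := [([[0,1]], [[1]]), ([[0,1],[-1]], [[1]]), ([[0,1,-1],[-1]], [[0,-1],[1]]),
      ([[0,1,-1,-1],[-1,0,2,2],[0,-1,-2,-1]], [[0,-1,-1],[1,1,-1],[0,2,2],[-1,-2,-1]]),
      ([[0,0,-1],[0,2,2],[-1,-2,-1]], [[0,-1],[1]]), ([[0,1],[-1,-1]], [[1]]),
      ([[0,1,-1,0,1],[-1,0,0,-2,-2],[0,0,1,2,1]], [[0,0,1,1],[0,-2,-1,1],[1,0,-2,-2],[0,1,2,1]])]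
    members := [(144, [1,2,3,4,5,6,7]), (145, [1,2,3,4,5,6,7])] },
  { F := [[0,0,-1], [0,2,3,4], [-1,-4,-12,-6,-2], [1,9,9,5,1,1], [-2,-3,-2]]
    k := 3
    b := [0,1,1,2,5,14]
    R := [([[0,1]], [[1]]), ([[0,1],[-1]], [[1]]), ([[0,1,-1],[-1]], [[0,-1],[1]]),
      ([[0,1,-1],[-1]], [[0,-1],[1,1]]), ([[0,1],[-1,-2,-4,1],[1,6,1],[-2,-1]], [[],[0,0,1]]),
      ([[0,1],[-1,-1]], [[1]]), ([[0,0,-1,1],[0,2,1,-2],[-1,-3,1],[1]], [[0,0,1],[0,-2,-1],[1,1]]),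
      ([[0,1,-1,1],[-1,0,-2,-3],[0,1,4,1,1],[0,-1]], [[0,0,1],[0,-2,-1],[1,1]]),
      ([[0,1],[-1,-2],[1]], [[1]]), ([[0,0,-1],[0,2,4],[-1,-6,-3,-1],[2,2,1]], [[0,-1],[1,1]])]
    members := [(160, [1,2,3,4,5,6,7,8]), (187, [1,6,2,4,5,6,9,10])] },
  { F := [[0,1], [-1,-2,-3,-1], [1,4,3,1,1], [-1,-1]]
    k := 0
    b := [0,1,1,2,5]
    R := [([[0,1]], [[1]]), ([[0,1],[-1,-1]], [[1]]), ([[0,1],[-1]], [[1]]), ([[0,1,-1],[-1]],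
      [[0,-1],[1,1]]), ([[0,1,-1],[-1]], [[0,-1],[1,1,1]]), ([[0,0,1],[0,-1,-2,-1],[0,1,1]],
      [[1,1],[-1,-2,-1],[1,1]]), ([[0,1],[-1,-1,-1]], [[1]]), ([[0,1],[-1,-2,-1],[1,1]], [[1]]),
      ([[0,1,-1],[-1]], [[0,-1],[1]]), ([[0,-1,0,1],[1,2,-1,1,-1],[-1,0,-1]],
      [[1,2,1],[-2,-3,-1,-1],[1]])]
    members := [(183, [1,2,3,4,5,6]), (186, [1,2,3,4,7,8]), (198, [1,2,3,4,7,8]), (205,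
      [1,5,2,3,7,8]), (161, [1,3,9,4,7,2,10]), (207, [1,5,2,3,7,2,8])] },
  { F := [[0,-1], [1,2,4], [-1,-6,-3,-1], [2,2,1]]
    k := 0
    b := [0,1,1,2,5,14]
    R := [([[0,1]], [[1]]), ([[0,1],[-1]], [[1]]), ([[0,1,-1],[-1]], [[0,-1],[1]]),
      ([[0,1,-1],[-1]], [[0,-1],[1,1]]), ([[0,1],[-1,-1]], [[1]]),
      ([[0,0,-1,1],[0,2,1,-2],[-1,-3,1],[1]], [[0,0,1],[0,-2,-1],[1,1]]), ([[0,1],[-1,-2],[1]],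
      [[1]])]
    members := [(165, [1,2,3,4,5,6]), (182, [1,5,2,4,5,7]), (195, [1,5,2,4,5,7])] },
  { F := [[0,-1], [1,2,2], [-1,-2,1,4,3,1], [0,-3,-9,-11,-7,-2], [1,4,7,7,4,1]]
    k := 0
    b := [0,1,1,2]
    R := [([[0,1]], [[1]]), ([[0,1],[-1,-1]], [[1]]), ([[0,1],[-1]], [[1]]), ([[0,1,-1],[-1]],
      [[0,-1],[1,1]]), ([[0,1],[-1,-1,-1]], [[1]]), ([[0,-1,1],[1]], [[0,1],[0,1,1],[-1,-2,-1]])]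
    members := [(177, [1,2,3,4,5,6]), (192, [1,2,3,4,5,6])] },
  { F := [[0,-1], [1,2,3], [-1,-4,0,3], [1,-2,-9,-6,-4], [1,6,6,6,2,1], [-1,-1,-1]]
    k := 0
    b := [0,1,1,2]
    R := [([[0,1]], [[1]]), ([[0,1],[-1,-1]], [[1]]), ([[0,1],[-1]], [[1]]), ([[0,1,-1],[-1]],
      [[0,-1],[1,1]]), ([[0,0,-1],[0,2,3],[-1,-4,-1,-1],[1]], [[0,-1],[1,1]]),
      ([[0,1],[-1,-2],[1]], [[1]]), ([[0,-1,1],[1]], [[0,1],[0,1],[-1,-1,-1]])]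
    members := [(178, [1,2,3,4,5,2,6,7]), (191, [1,2,3,4,5,2,6,7])] }]

/-- Patterns that are Wilf equivalent only to themselves and to their mirror images. -/
def isolated : List ℕ := [0, 131, 133, 163, 164, 169, 170, 200]

/-! ### Verification of the classes and their number -/

theorem certificates_ok :
    (certificates.all fun c => c.rootOK && c.systemOK patterns) = true := by
  decide +kernel

/-- The Wilf classes, up to mirror images, in terms of positions of patterns. -/
def classes : List (List ℕ) :=
  certificates.map (fun c => c.members.map Prod.fst) ++ isolated.map fun i => [i]

/-- The first pattern of each class. -/
def representatives : List ℕ := classes.map fun g => g.headD 0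

theorem length_representatives : representatives.length = 43 := by
  decide +kernel

/-- One pattern of each mirror pair suffices, by `avoiderSeries_mirror`. -/
theorem classes_cover : (patterns.all fun t => classes.any fun g => g.any fun i =>
    eqB (pattern i) t || eqB (mirror (pattern i)) t) = true := by
  decide +kernel

theorem numLeaves_representatives :
    (representatives.all fun i => Nat.beq (pattern i).numLeaves 8) = true := by
  decide +kernel

theorem avoiderSeries_eq_of_mem_classes {g : List ℕ} (hg : g ∈ classes) :
    ∃ a, ∀ i ∈ g, avoiderSeries (pattern i) .nil = a := by
  rcases List.mem_append.1 hg with hg | hg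
  · obtain ⟨c, hc, rfl⟩ := List.mem_map.1 hg
    have h := List.all_eq_true.1 certificates_ok c hc
    rw [Bool.and_eq_true] at h
    obtain ⟨a, ha⟩ := Certificate.exists_avoiderSeries_eq h.1 h.2
    refine ⟨a, fun i hi => ?_⟩
    obtain ⟨m, hm, rfl⟩ := List.mem_map.1 hi
    exact ha m hm
  · obtain ⟨i, -, rfl⟩ := List.mem_map.1 hg
    exact ⟨_, fun j hj => by rw [List.mem_singleton.1 hj]⟩

theorem exists_representative {t : BinaryTree Unit} (ht : t.numLeaves = 8) :
    ∃ i ∈ representatives, avoiderSeries (pattern i) .nil = avoiderSeries t .nil := by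
  have h := List.all_eq_true.1 classes_cover t (mem_patterns ht)
  obtain ⟨g, hg, h⟩ := List.any_eq_true.1 h
  obtain ⟨i, hi, h⟩ := List.any_eq_true.1 h
  rw [Bool.or_eq_true, eqB_iff, eqB_iff] at h
  obtain ⟨a, ha⟩ := avoiderSeries_eq_of_mem_classes hg
  have hhead : g.headD 0 ∈ g := by
    cases g with
    | nil => simp at hi
    | cons j g => simp
  refine ⟨g.headD 0, List.mem_map.2 ⟨g, hg, rfl⟩, ?_⟩
  rw [ha _ hhead, ← ha i hi]
  rcases h with rfl | rfl
  · rfl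
  · exact (avoiderSeries_mirror _).symm

/-- Do all codes exist, and are they pairwise different? -/
def distinct : List (Option ℤ) → Bool
  | [] => true
  | none :: _ => false
  | some v :: l => (l.all fun o => match o with
    | some w => !(v == w)
    | none => false) && distinct l

theorem pairwise_of_distinct {l : List (Option ℤ)} (h : distinct l = true) :
    l.Pairwise fun o o' => ∃ v w, o = some v ∧ o' = some w ∧ v ≠ w := by
  induction l with
  | nil => exact List.Pairwise.nil
  | cons o l ih =>
    cases o with
    | none => simp [distinct] at h
    | some v =>
      rw [distinct, Bool.and_eq_true, List.all_eq_true] at h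
      refine List.Pairwise.cons (fun o' ho' => ?_) (ih h.2)
      have := h.1 o' ho'
      cases o' with
      | none => simp at this
      | some w => exact ⟨v, w, rfl, rfl, by simpa using this⟩

/-- Coefficients below X^26 already separate the 43 classes. -/
theorem distinct_codes : distinct (representatives.map fun i => code (pattern i)) = true := by
  decide +kernel

theorem pairwise_representatives : representatives.Pairwise fun i j =>
    avoiderSeries (pattern i) .nil ≠ avoiderSeries (pattern j) .nil := by
  have h := pairwise_of_distinct distinct_codes
  rw [List.pairwise_map] at h
  refine h.imp ?_
  rintro i j ⟨v, w, hv, hw, hne⟩ h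
  exact hne (code_eq_of_avoiderSeries_eq hv hw h)

/-- There are 43 Wilf classes of patterns with eight leaves. -/
theorem card_quotient_eq (r : Setoid (TreeWithLeaves 8))
    (hr : ∀ s t, r.r s t ↔ avoiderSeries s.1 .nil = avoiderSeries t.1 .nil) :
    Nat.card (Quotient r) = 43 := by
  have hleaves : ∀ i : Fin representatives.length,
      (pattern representatives[i]).numLeaves = 8 := fun i =>
    Nat.eq_of_beq_eq_true
      (List.all_eq_true.1 numLeaves_representatives _ (List.getElem_mem i.2))
  -- Injectivity comes from the codes, surjectivity from the certificates. Only `hr` is known about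
  -- r, so the count applies to patterns and to operads.
  let f : Fin representatives.length → Quotient r := fun i => Quotient.mk r ⟨_, hleaves i⟩
  have hf : Function.Bijective f := by
    constructor
    · intro i j hij
      have h := (hr _ _).1 (Quotient.exact hij)
      have hp := List.pairwise_iff_getElem.1 pairwise_representatives
      rcases lt_trichotomy i j with hlt | heq | hlt
      · exact absurd h (hp i j i.2 j.2 hlt)
      · exact heq
      · exact absurd h.symm (hp j i j.2 i.2 hlt)
    · intro q
      induction q using Quotient.inductionOn with
      | h t =>
        obtain ⟨i, hi, h⟩ := exists_representative t.2
        obtain ⟨j, hj, rfl⟩ := List.getElem_of_mem hi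
        exact ⟨⟨j, hj⟩, Quotient.sound ((hr _ _).2 h)⟩
  rw [← Nat.card_congr (Equiv.ofBijective f hf), Nat.card_fin, length_representatives]

end PatternAvoidance

namespace PatternAvoidance

/-! ### Monomial operads -/

/-- The second tree is obtained from the first one by grafting a tree onto a leaf. -/
def GraftStep (S S' : BinaryTree Unit) : Prop := ∃ i < S.numLeaves, ∃ T, S' = graft S i T

theorem graft_node_left {l : BinaryTree Unit} {i : ℕ} (hi : i < l.numLeaves) (a : Unit)
    (r T : BinaryTree Unit) : graft (.node a l r) i T = .node a (graft l i T) r := by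
  rw [graft, if_pos hi]

theorem graft_node_right (l r : BinaryTree Unit) (i : ℕ) (a : Unit) (T : BinaryTree Unit) :
    graft (.node a l r) (l.numLeaves + i) T = .node a l (graft r i T) := by
  rw [graft, if_neg (by omega), Nat.add_sub_cancel_left]

/-- Leaves are replaced inside the left branch and then inside the right one; a graft in a branch is
a graft in the whole tree, with positions in the right branch shifted by the number of leaves of the
left one. -/
theorem reflTransGen_graftStep {t T : BinaryTree Unit} (h : RootedSubtree t T) :
    Relation.ReflTransGen GraftStep t T := by
  induction t generalizing T with
  | nil => exact Relation.ReflTransGen.single ⟨0, by simp, T, rfl⟩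
  | node a l r hl hr =>
    cases T with
    | nil => exact h.elim
    | node b l' r' =>
      refine Relation.ReflTransGen.trans (b := .node a l' r) ?_ ?_
      · refine Relation.ReflTransGen.lift (fun s => BinaryTree.node a s r) ?_ _ _ (hl h.1)
        rintro S _ ⟨i, hi, T, rfl⟩
        exact ⟨i, by simp only [BinaryTree.numLeaves]; omega, T, (graft_node_left hi a r T).symm⟩
      · refine Relation.ReflTransGen.lift (fun s => BinaryTree.node a l' s) ?_ _ _ (hr h.2)
        rintro S _ ⟨i, hi, T, rfl⟩
        exact ⟨l'.numLeaves + i, by simp only [BinaryTree.numLeaves]; omega, T,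
          (graft_node_right l' S i a T).symm⟩

theorem rootedSubtree_refl (T : BinaryTree Unit) : RootedSubtree T T := by
  induction T with
  | nil => trivial
  | node a l r hl hr => exact ⟨hl, hr⟩

theorem rootedSubtree_graft {t S : BinaryTree Unit} (h : RootedSubtree t S) (i : ℕ)
    (T : BinaryTree Unit) : RootedSubtree t (graft S i T) := by
  induction S generalizing t i with
  | nil =>
    cases t with
    | nil => exact rootedSubtree_nil _
    | node => exact h.elim
  | node a l r hl hr =>
    rw [rootedSubtree_node] at h
    rw [graft]
    split_ifs <;> rw [rootedSubtree_node]
    · exact ⟨hl h.1 i, h.2⟩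
    · exact ⟨h.1, hr h.2 _⟩

theorem containsPattern_graft_left {t S : BinaryTree Unit} (h : ContainsPattern t S) (i : ℕ)
    (T : BinaryTree Unit) : ContainsPattern t (graft S i T) := by
  induction S generalizing i with
  | nil => exact containsPattern_of_rootedSubtree (rootedSubtree_graft (S := .nil) h i T)
  | node a l r hl hr =>
    rcases h with h | h
    · exact containsPattern_of_rootedSubtree (rootedSubtree_graft h i T)
    · rw [graft]
      split_ifs
      · exact Or.inr (h.imp (fun h => hl h i) id)
      · exact Or.inr (h.imp id fun h => hr h _)

theorem containsPattern_graft_right {t T : BinaryTree Unit} (h : ContainsPattern t T)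
    (S : BinaryTree Unit) (i : ℕ) : ContainsPattern t (graft S i T) := by
  induction S generalizing i with
  | nil => exact h
  | node a l r hl hr =>
    rw [graft]
    split_ifs
    · exact Or.inr (Or.inl (hl i))
    · exact Or.inr (Or.inr (hr _))

variable {K : Type u} [Field K]

/-! ### The ideal generated by a monomial -/

theorem freeComp_mem_supported_left {t : BinaryTree Unit} {l m n : ℕ} (h : n + 1 = l + m)
    (i : Fin l) {a : TreeWithLeaves l →₀ K} (b : TreeWithLeaves m →₀ K)
    (ha : a ∈ Finsupp.supported K K {T : TreeWithLeaves l | ContainsPattern t T.1}) :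
    freeComp K h i a b ∈ Finsupp.supported K K {T : TreeWithLeaves n | ContainsPattern t T.1} := by
  rw [Finsupp.supported_eq_span_single] at ha
  induction ha using Submodule.span_induction with
  | mem a ha =>
    obtain ⟨S, hS, rfl⟩ := ha
    induction b using Finsupp.induction_linear with
    | zero => simp
    | add f g hf hg => rw [map_add]; exact add_mem hf hg
    | single T x =>
      rw [freeComp_single]
      exact Finsupp.single_mem_supported K _ (containsPattern_graft_left hS _ _)
  | zero => simp
  | add f g _ _ hf hg => rw [map_add, LinearMap.add_apply]; exact add_mem hf hg
  | smul c f _ hf => rw [map_smul, LinearMap.smul_apply]; exact Submodule.smul_mem _ _ hf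

theorem freeComp_mem_supported_right {t : BinaryTree Unit} {l m n : ℕ} (h : n + 1 = l + m)
    (i : Fin l) (a : TreeWithLeaves l →₀ K) {b : TreeWithLeaves m →₀ K}
    (hb : b ∈ Finsupp.supported K K {T : TreeWithLeaves m | ContainsPattern t T.1}) :
    freeComp K h i a b ∈ Finsupp.supported K K {T : TreeWithLeaves n | ContainsPattern t T.1} := by
  rw [Finsupp.supported_eq_span_single] at hb
  induction hb using Submodule.span_induction with
  | mem b hb =>
    obtain ⟨T, hT, rfl⟩ := hb
    induction a using Finsupp.induction_linear with
    | zero => simp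
    | add f g hf hg => rw [map_add, LinearMap.add_apply]; exact add_mem hf hg
    | single S x =>
      rw [freeComp_single]
      exact Finsupp.single_mem_supported K _ (containsPattern_graft_right hT _ _)
  | zero => simp
  | add f g _ _ hf hg => rw [map_add]; exact add_mem hf hg
  | smul c f _ hf => rw [map_smul]; exact Submodule.smul_mem _ _ hf

/-- The monomials that contain a pattern span an operadic ideal. -/
noncomputable def patternIdeal (K : Type u) [Field K] (t : BinaryTree Unit) :
    (freeBinaryOperad K).OperadIdeal where
  carrier n := Finsupp.supported K K {T : TreeWithLeaves n | ContainsPattern t T.1}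
  comp_left_mem h i _ b ha := freeComp_mem_supported_left h i b ha
  comp_right_mem h i a _ hb := freeComp_mem_supported_right h i a hb

/-- The ideal contains the monomial `T`. -/
def MonomialMem (J : (freeBinaryOperad K).OperadIdeal) (T : BinaryTree Unit) : Prop :=
  ∀ (n : ℕ) (h : T.numLeaves = n), (Finsupp.single (⟨T, h⟩ : TreeWithLeaves n) (1 : K)) ∈ J.carrier n

theorem monomialMem_iff (J : (freeBinaryOperad K).OperadIdeal) {n : ℕ} (T : TreeWithLeaves n) :
    MonomialMem J T.1 ↔ (Finsupp.single T (1 : K)) ∈ J.carrier n := by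
  refine ⟨fun h => h n T.2, fun h m hm => ?_⟩
  obtain rfl : n = m := T.2.symm.trans hm
  exact h

theorem comp_single (S T : BinaryTree Unit) {i n : ℕ} (hi : i < S.numLeaves)
    (hn : (graft S i T).numLeaves = n) (h : n + 1 = S.numLeaves + T.numLeaves) :
    (freeBinaryOperad K).comp h ⟨i, hi⟩
      (Finsupp.single (⟨S, rfl⟩ : TreeWithLeaves S.numLeaves) (1 : K))
      (Finsupp.single (⟨T, rfl⟩ : TreeWithLeaves T.numLeaves) (1 : K))
      = Finsupp.single (⟨graft S i T, hn⟩ : TreeWithLeaves n) (1 : K) := by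
  have := freeComp_single K h ⟨i, hi⟩ ⟨S, rfl⟩ ⟨T, rfl⟩ 1 1
  rw [mul_one] at this
  exact this

theorem MonomialMem.graft_left {J : (freeBinaryOperad K).OperadIdeal} {S : BinaryTree Unit}
    (hS : MonomialMem J S) {i : ℕ} (hi : i < S.numLeaves) (T : BinaryTree Unit) :
    MonomialMem J (graft S i T) := by
  intro n hn
  have h : n + 1 = S.numLeaves + T.numLeaves := hn ▸ numLeaves_graft S i T
  rw [← comp_single S T hi hn h]
  exact J.comp_left_mem h ⟨i, hi⟩ _ (hS _ rfl)

theorem MonomialMem.graft_right {J : (freeBinaryOperad K).OperadIdeal} {T : BinaryTree Unit}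
    (hT : MonomialMem J T) (S : BinaryTree Unit) {i : ℕ} (hi : i < S.numLeaves) :
    MonomialMem J (graft S i T) := by
  intro n hn
  have h : n + 1 = S.numLeaves + T.numLeaves := hn ▸ numLeaves_graft S i T
  rw [← comp_single S T hi hn h]
  exact J.comp_right_mem h ⟨i, hi⟩ _ (hT _ rfl)

/-- Growing a tree at its leaves is a chain of compositions with the ideal element on the left. -/
theorem MonomialMem.of_rootedSubtree {J : (freeBinaryOperad K).OperadIdeal} {t T : BinaryTree Unit}
    (ht : MonomialMem J t) (h : RootedSubtree t T) : MonomialMem J T := by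
  have h' := reflTransGen_graftStep h
  clear h
  induction h' with
  | refl => exact ht
  | tail _ hs ih =>
    obtain ⟨i, hi, U, rfl⟩ := hs
    exact ih.graft_left hi U

theorem MonomialMem.of_containsPattern {J : (freeBinaryOperad K).OperadIdeal}
    {t T : BinaryTree Unit} (ht : MonomialMem J t) (h : ContainsPattern t T) : MonomialMem J T := by
  induction T with
  | nil => exact ht.of_rootedSubtree h
  | node a l r hl hr =>
    rcases h with h | h | h
    · exact ht.of_rootedSubtree h
    -- The tree is recovered by composing its left branch into the first leaf of the node with right
    -- branch r, an ideal element on the right; the other case is symmetric.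
    · have := (hl h).graft_right (.node a .nil r) (i := 0) (by simp only [BinaryTree.numLeaves]; omega)
      rwa [graft_node_left (by simp)] at this
    · have := (hr h).graft_right (.node a l .nil) (i := l.numLeaves + 0)
        (by simp only [BinaryTree.numLeaves]; omega)
      rwa [graft_node_right] at this

/-- The ideal generated by a monomial is spanned by the monomials that contain it. -/
theorem carrier_idealGenerated {d : ℕ} (t : TreeWithLeaves d) (n : ℕ) :
    ((freeBinaryOperad K).idealGenerated (d := d) (Finsupp.single t (1 : K))).carrier n
      = (patternIdeal K t.1).carrier n := by
  apply le_antisymm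
  -- The span of the trees containing t is one of the ideals being intersected; the converse
  -- inclusion checks monomials in an arbitrary such ideal.
  · refine iInf_le_of_le ⟨patternIdeal K t.1, ?_⟩ le_rfl
    exact Finsupp.single_mem_supported K _
      (containsPattern_of_rootedSubtree (rootedSubtree_refl t.1))
  · refine le_iInf fun J => ?_
    refine (Finsupp.supported_eq_span_single K _).trans_le (Submodule.span_le.2 ?_)
    rintro _ ⟨T, hT, rfl⟩
    exact (monomialMem_iff J.1 T).1 (((monomialMem_iff J.1 t).2 J.2).of_containsPattern hT)

instance (n : ℕ) : Finite (TreeWithLeaves n) :=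
  Set.Finite.to_subtype ((treesWithLeaves n).finite_toSet.subset fun _ h =>
    mem_treesWithLeaves.2 h)

theorem finrank_quotient_supported {α : Type*} [Finite α] (s : Set α) :
    Module.finrank K ((α →₀ K) ⧸ Finsupp.supported K K s) = sᶜ.ncard := by
  classical
  have := Fintype.ofFinite α
  have h1 := Submodule.finrank_quotient_add_finrank (Finsupp.supported K K s)
  have h2 := (Finsupp.supportedEquivFinsupp (M := K) (R := K) s).finrank_eq
  rw [Module.finrank_finsupp_self] at h1 h2
  have h3 := Set.ncard_add_ncard_compl s
  rw [← Nat.card_eq_fintype_card] at h1 h2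
  rw [Nat.card_coe_set_eq] at h2
  omega

/-- The dimensions of a one-relator monomial operad count pattern-avoiding trees. -/
theorem finrank_oneRelatorOperad {d : ℕ} (t : TreeWithLeaves d) (n : ℕ) :
    Module.finrank K ((oneRelatorOperad K t).obj n) = (avoiders t.1 .nil n).card := by
  have h1 : Module.finrank K ((oneRelatorOperad K t).obj n)
      = {T : TreeWithLeaves n | ContainsPattern t.1 T.1}ᶜ.ncard := by
    rw [← finrank_quotient_supported (K := K)]
    exact (Submodule.quotEquivOfEq _ _ (carrier_idealGenerated t n)).finrank_eq
  rw [h1, ← Set.ncard_coe_finset, ← Set.ncard_image_of_injective _ Subtype.val_injective]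
  congr 1
  ext T
  simp only [Set.mem_image, Set.mem_compl_iff, Set.mem_ofPred_eq, Subtype.exists, exists_and_left,
    exists_prop, exists_eq_right_right, Finset.mem_coe, mem_avoiders, AvoidsPattern,
    rootedSubtree_nil, and_true]
  tauto

theorem operad_wilfEquivalent_iff {d e : ℕ} (s : TreeWithLeaves d) (t : TreeWithLeaves e) :
    NSOperad.WilfEquivalent (oneRelatorOperad K s) (oneRelatorOperad K t) ↔
      avoiderSeries s.1 .nil = avoiderSeries t.1 .nil := by
  simp only [NSOperad.WilfEquivalent, NSOperad.generatingSeries, avoiderSeries,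
    PowerSeries.ext_iff, PowerSeries.coeff_mk, finrank_oneRelatorOperad, Nat.cast_inj]

end PatternAvoidance

theorem mainTheorem5 :
    numWilfClasses 8 = 43 ∧
    ∀ (K : Type u) [Field K],
      (∀ s t : TreeWithLeaves 8,
        NSOperad.WilfEquivalent (oneRelatorOperad K s) (oneRelatorOperad K t) ↔
          WilfEquivalent s.1 t.1) ∧
      numOperadWilfClasses K 8 = 43 :=
  ⟨PatternAvoidance.card_quotient_eq _ fun s t => PatternAvoidance.wilfEquivalent_iff s.1 t.1,
    fun _ _ => ⟨fun s t => (PatternAvoidance.operad_wilfEquivalent_iff s t).trans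
        (PatternAvoidance.wilfEquivalent_iff s.1 t.1).symm,
      PatternAvoidance.card_quotient_eq _ PatternAvoidance.operad_wilfEquivalent_iff⟩⟩
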